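/- **Setup.** Let $0\le\delta\le 1$ and $B,C\ge 0$ be real. For $n\ge 1$ put $m=\lfloor n^{\delta}\rfloor$, and let $\mathcal M_{n,\delta}(B,C)$ be the (finite, nonempty) set of $(m+n)\times(m+n)$ tables with entries in $\mathbb N=\{0,1,2,\dots\}$ whose first $m$ row sums and first $m$ column sums are all equal to $\lfloor BCn\rfloor$ and whose last $n$ row sums and last $n$ column sums are all equal to $\lfloor Cn\rfloor$. Let $X=(X_{ij})$ be uniformly distributed on $\mathcal M_{n,\delta}(B,C)$. Let the typical table $Z=(z_{ij})$ be the unique maximizer of $$g(W)=\sum_{i,j}\bigl[(W_{ij}+1)\log(W_{ij}+1)-W_{ij}\log W_{ij}\bigr]\qquad(0\log 0=0)$$ over all tables $W$ of nonnegative real numbers with the same row and column sums. Let $Y=(Y_{ij})$ be a random table with independent entries $Y_{ij}\sim\mathrm{Geom}(z_{ij})$, where $\mathrm{Geom}(\lambda)$ is the law on $\mathbb N$ with mean $\lambda\ge 0$ and mass function $l\mapsto\frac1{1+\lambda}\bigl(\frac{\lambda}{1+\lambda}\bigr)^{l}$ (with $0^0=1$, so that $\mathrm{Geom}(0)$ is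 the point mass at $0$). For random variables $U,V$ with values in a countable set let $d_{TV}(U,V)=\sum_x|\mathbb P(U=x)-\mathbb P(V=x)|$. **Theorem.** Fix $0\le\delta\le1$, $B,C\ge0$, an integer $k\ge 1$ and $\varepsilon>0$. Then for all sufficiently large $n$ and all positions $(i_1,j_1),\dots,(i_k,j_k)$ with $1\le i_r,j_r\le m+n$ (not necessarily distinct, and allowed to depend on $n$), $$d_{TV}\Bigl(\prod_{r=1}^k X_{i_r,j_r},\ \prod_{r=1}^k Y_{i_r,j_r}\Bigr)\le n^{-\eta(\delta)+\varepsilon} \qquad\text{and}\qquad d_{TV}\Bigl(\bigl(X_{i_r,j_r}\bigr)_{r=1}^k,\ \bigl(Y_{i_r,j_r}\bigr)_{r=1}^k\Bigr)\le n^{-\eta(\delta)+\varepsilon},$$ where $$\eta(\delta)=\begin{cases}1/2 & \text{if all positions lie in the bottom right block } (i_r>m \text{ and } j_r>m \text{ for all } r),\\ \delta-1/2 & \text{if some position lies in the top left block } (i_r\le m \text{ and } j_r\le m \text{ for some } r),\\ \delta/2 & \text{otherwise.}\end{cases}$$ -/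

import Mathlib

open MeasureTheory ProbabilityTheory Filter
open scoped NNReal

namespace ContingencyTable

noncomputable section

section General

variable {ι κ : Type*} [Fintype ι] [Fintype κ]

/-- Contingency tables: tables of natural numbers with row sums `r` and column sums `c`. -/
def tables (r : ι → ℕ) (c : κ → ℕ) : Set (ι → κ → ℕ) :=
  {M | (∀ i, ∑ j, M i j = r i) ∧ (∀ j, ∑ i, M i j = c j)}

/-- The transportation polytope: nonnegative real tables with row sums `r` and column sums `c`. -/
def polytope (r : ι → ℕ) (c : κ → ℕ) : Set (ι → κ → ℝ) :=
  {W | (∀ i j, 0 ≤ W i j) ∧ (∀ i, ∑ j, W i j = r i) ∧ (∀ j, ∑ i, W i j = c j)}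

/-- `f(x) = (x + 1) log (x + 1) - x log x`, with `0 log 0 = 0`. -/
def entropyFun (x : ℝ) : ℝ := (x + 1) * Real.log (x + 1) - x * Real.log x

/-- `g(W) = ∑ f(W i j)`, the sum being over all entries of the table. -/
def tableEntropy (W : ι → κ → ℝ) : ℝ := ∑ i, ∑ j, entropyFun (W i j)

lemma continuous_entropyFun : Continuous entropyFun :=
  (Real.continuous_mul_log.comp (continuous_id.add continuous_const)).sub Real.continuous_mul_log

lemma hasDerivAt_entropyFun {x : ℝ} (hx : 0 < x) :
    HasDerivAt entropyFun (Real.log (x + 1) - Real.log x) x := by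
  have h1 : HasDerivAt (fun y : ℝ => (y + 1) * Real.log (y + 1)) (Real.log (x + 1) + 1) x :=
    HasDerivAt.comp_add_const x 1 (Real.hasDerivAt_mul_log (by positivity))
  have h2 := h1.sub (Real.hasDerivAt_mul_log hx.ne')
  exact h2.congr_deriv (by ring)

lemma strictConcaveOn_entropyFun : StrictConcaveOn ℝ (Set.Ici (0 : ℝ)) entropyFun := by
  refine StrictAntiOn.strictConcaveOn_of_deriv (convex_Ici 0)
    continuous_entropyFun.continuousOn ?_
  rw [interior_Ici]
  intro x hx y hy hxy
  have hx : 0 < x := hx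
  have hy : 0 < y := hy
  rw [(hasDerivAt_entropyFun hx).deriv, (hasDerivAt_entropyFun hy).deriv,
    ← Real.log_div (by positivity) (by positivity), ← Real.log_div (by positivity) (by positivity)]
  apply Real.log_lt_log (by positivity)
  rw [div_lt_div_iff₀ hy hx]
  nlinarith

lemma polytope_convex (r : ι → ℕ) (c : κ → ℕ) : Convex ℝ (polytope r c) := by
  intro U hU V hV a b ha hb hab
  refine ⟨fun i j => ?_, fun i => ?_, fun j => ?_⟩
  · have := hU.1 i j
    have := hV.1 i j
    simp only [Pi.add_apply, Pi.smul_apply, smul_eq_mul]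
    positivity
  · simp only [Pi.add_apply, Pi.smul_apply, smul_eq_mul, Finset.sum_add_distrib,
      ← Finset.mul_sum, hU.2.1, hV.2.1]
    rw [← add_mul, hab, one_mul]
  · simp only [Pi.add_apply, Pi.smul_apply, smul_eq_mul, Finset.sum_add_distrib,
      ← Finset.mul_sum, hU.2.2, hV.2.2]
    rw [← add_mul, hab, one_mul]

lemma polytope_isCompact (r : ι → ℕ) (c : κ → ℕ) : IsCompact (polytope r c) := by
  have hK : IsCompact (Set.univ.pi fun i : ι => Set.univ.pi fun _ : κ =>
      Set.Icc (0 : ℝ) (r i)) :=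
    isCompact_univ_pi fun i => isCompact_univ_pi fun _ => isCompact_Icc
  refine hK.of_isClosed_subset ?_ ?_
  · have e : polytope r c = (⋂ i, ⋂ j, {W : ι → κ → ℝ | 0 ≤ W i j}) ∩
        ((⋂ i, {W : ι → κ → ℝ | ∑ j, W i j = r i}) ∩
          (⋂ j, {W : ι → κ → ℝ | ∑ i, W i j = c j})) := by
      ext W
      simp [polytope]
    rw [e]
    refine (isClosed_iInter fun i => isClosed_iInter fun j => ?_).inter
      ((isClosed_iInter fun i => ?_).inter (isClosed_iInter fun j => ?_))
    · exact isClosed_le continuous_const (by fun_prop)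
    · exact isClosed_eq (by fun_prop) continuous_const
    · exact isClosed_eq (by fun_prop) continuous_const
  · intro W hW i _ j _
    refine ⟨hW.1 i j, ?_⟩
    rw [← hW.2.1 i]
    exact Finset.single_le_sum (f := fun j => W i j) (fun j _ => hW.1 i j) (Finset.mem_univ j)

lemma strictConcaveOn_tableEntropy (r : ι → ℕ) (c : κ → ℕ) :
    StrictConcaveOn ℝ (polytope r c) tableEntropy := by
  refine ⟨polytope_convex r c, ?_⟩
  intro U hU V hV hne a b ha hb hab
  obtain ⟨i, hi⟩ := Function.ne_iff.1 hne
  obtain ⟨j, hj⟩ := Function.ne_iff.1 hi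
  have hle : ∀ i j, a * entropyFun (U i j) + b * entropyFun (V i j) ≤
      entropyFun (a * U i j + b * V i j) := fun i j =>
    strictConcaveOn_entropyFun.concaveOn.2 (hU.1 i j) (hV.1 i j) ha.le hb.le hab
  have hlt : a * entropyFun (U i j) + b * entropyFun (V i j) <
      entropyFun (a * U i j + b * V i j) :=
    strictConcaveOn_entropyFun.2 (hU.1 i j) (hV.1 i j) hj ha hb hab
  simp only [tableEntropy, Pi.add_apply, Pi.smul_apply, smul_eq_mul, Finset.mul_sum,
    ← Finset.sum_add_distrib]
  exact Finset.sum_lt_sum (fun i _ => Finset.sum_le_sum fun j _ => hle i j)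
    ⟨i, Finset.mem_univ i, Finset.sum_lt_sum (fun j _ => hle i j) ⟨j, Finset.mem_univ j, hlt⟩⟩

/-- On a nonempty transportation polytope `g` has exactly one maximizer. -/
theorem existsUnique_typicalTable (r : ι → ℕ) (c : κ → ℕ) (h : (polytope r c).Nonempty) :
    ∃! Z, Z ∈ polytope r c ∧ IsMaxOn tableEntropy (polytope r c) Z := by
  have hc : Continuous (tableEntropy : (ι → κ → ℝ) → ℝ) := by
    refine continuous_finsetSum _ fun i _ => continuous_finsetSum _ fun j _ => ?_
    exact continuous_entropyFun.comp (by fun_prop)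
  obtain ⟨Z, hZ, hmax⟩ := (polytope_isCompact r c).exists_isMaxOn h hc.continuousOn
  exact ⟨Z, ⟨hZ, hmax⟩, fun W hW =>
    (strictConcaveOn_tableEntropy r c).eq_of_isMaxOn hW.2 hmax hW.1 hZ⟩

/-- The typical table: the unique maximizer of `g` on the transportation polytope. -/
def typicalTable (r : ι → ℕ) (c : κ → ℕ) (h : (polytope r c).Nonempty) : ι → κ → ℝ :=
  (existsUnique_typicalTable r c h).choose

lemma typicalTable_spec (r : ι → ℕ) (c : κ → ℕ) (h : (polytope r c).Nonempty) :
    typicalTable r c h ∈ polytope r c ∧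
      IsMaxOn tableEntropy (polytope r c) (typicalTable r c h) :=
  (existsUnique_typicalTable r c h).choose_spec.1

/-- The law of a uniformly random contingency table with margins `r`, `c`. -/
def uniformTableLaw (r : ι → ℕ) (c : κ → ℕ) : Measure (ι → κ → ℕ) := uniformOn (tables r c)

/-- `Geom(a)`, the geometric law on `ℕ` with mean `a`: success probability `1 / (1 + a)`. -/
def geomLaw (a : ℝ≥0) : Measure ℕ :=
  geometricMeasure ⟨1 / (1 + a), by positivity,
    div_le_one_of_le₀ (le_add_of_nonneg_right a.2) (by positivity)⟩

/-- The mass function of `Geom(a)`; in particular `Geom(0)` is the point mass at `0`. -/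
lemma geomLaw_real_singleton (a : ℝ≥0) (l : ℕ) :
    (geomLaw a).real {l} = (1 / (1 + a)) * ((a : ℝ) / (1 + a)) ^ l := by
  have h : (1 : ℝ) + a ≠ 0 := by positivity
  rw [geomLaw, geometricMeasure_real_singleton]
  · have e : 1 - 1 / (1 + (a : ℝ)) = (a : ℝ) / (1 + a) := by field_simp; ring
    simp only [e]
    ring
  · intro h0
    have := congrArg Subtype.val h0
    simp [h] at this

/-- The law of a random table with independent entries, the `(i, j)` entry being
`Geom(Z i j)`. It is used for tables `Z` with nonnegative entries only. -/
def geomTableLaw (Z : ι → κ → ℝ) : Measure (ι → κ → ℕ) :=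
  Measure.pi fun i => Measure.pi fun j => geomLaw (Z i j).toNNReal

end General

/-- The total variation distance of two laws on a countable space, with the normalization
`∑ x, |μ x - ν x|` (without a factor `1 / 2`). -/
def tvDist {α : Type*} [MeasurableSpace α] (μ ν : Measure α) : ℝ :=
  ∑' x, |μ.real {x} - ν.real {x}|

/-- The number `⌊n ^ δ⌋` of rows (and of columns) with the large margin. -/
def bezel (n : ℕ) (δ : ℝ) : ℕ := ⌊(n : ℝ) ^ δ⌋₊

/-- The margins: the first `⌊n ^ δ⌋` are `⌊B C n⌋`, the remaining `n` are `⌊C n⌋`. -/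
def margin (n : ℕ) (δ B C : ℝ) (i : Fin (bezel n δ + n)) : ℕ :=
  if (i : ℕ) < bezel n δ then ⌊B * C * n⌋₊ else ⌊C * n⌋₊

/-- The polytope is nonempty: it contains the diagonal table. -/
lemma polytope_margin_nonempty (n : ℕ) (δ B C : ℝ) :
    (polytope (margin n δ B C) (margin n δ B C)).Nonempty :=
  ⟨fun i j => if i = j then (margin n δ B C i : ℝ) else 0,
    fun i j => by dsimp only; split_ifs <;> positivity, fun i => by simp, fun j => by simp⟩

/-- The set of tables is nonempty: it contains the diagonal table. -/
lemma tables_margin_nonempty (n : ℕ) (δ B C : ℝ) :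
    (tables (margin n δ B C) (margin n δ B C)).Nonempty :=
  ⟨fun i j => if i = j then margin n δ B C i else 0, fun i => by simp, fun j => by simp⟩

/-- The law of the random table `X` that is uniform on `M_{n,δ}(B, C)`. -/
def lawX (n : ℕ) (δ B C : ℝ) :
    Measure (Fin (bezel n δ + n) → Fin (bezel n δ + n) → ℕ) :=
  uniformTableLaw (margin n δ B C) (margin n δ B C)

/-- The law of the random table `Y` with independent entries `Y i j ∼ Geom(z i j)`,
where `z` is the typical table of `M_{n,δ}(B, C)`. -/
def lawY (n : ℕ) (δ B C : ℝ) :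
    Measure (Fin (bezel n δ + n) → Fin (bezel n δ + n) → ℕ) :=
  geomTableLaw (typicalTable (margin n δ B C) (margin n δ B C)
    (polytope_margin_nonempty n δ B C))

/-- The exponent `η(δ)` of the positions `(i s, j s)`: `1/2` if all of them are in the bottom
right block, `δ - 1/2` if some of them is in the top left block, `δ/2` otherwise. -/
def eta (n : ℕ) (δ : ℝ) {k : ℕ} (i j : Fin k → Fin (bezel n δ + n)) : ℝ :=
  if ∀ s, bezel n δ ≤ (i s : ℕ) ∧ bezel n δ ≤ (j s : ℕ) then 1 / 2
  else if ∃ s, (i s : ℕ) < bezel n δ ∧ (j s : ℕ) < bezel n δ then δ - 1 / 2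
  else δ / 2

end

end ContingencyTable

/-! The proof combines transference, exchangeability and concentration.

Transference: the first order condition at the typical table Z gives every contingency table
probability at least exp(-g(Z)) under the geometric law. Hence the uniform law is at most exp(g(Z) -
log #tables) times the geometric law (`uniformTableLaw_real_le`), and this factor is exp(O(n log n))
(`tableEntropy_typicalTable_le`).

Exchangeability and concentration: the margins, and by uniqueness Z, are invariant under
permutations inside the two blocks of rows and of columns. An event about k entries therefore keeps
its probability, in both models, when the positions are shifted inside the blocks. The shifts give
at least about n², m² or mn copies in the three cases of η, that is n^(1+2η) up to constants, and a
fraction 1/k² of them can be chosen pairwise disjoint. By Hoeffding, the frequency of the event over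
disjoint copies deviates by t = n^(-η+ε/2) with geometric probability at most 2 exp(-c n^(1+ε)),
which beats the transference factor. So the frequency is concentrated under the uniform law as well,
and its mean there is the uniform probability (`abs_uniformTableLaw_sub_geomTableLaw_le`).

The entropy gap: averaging Z over blocks only raises g, and integer fillings of the blocks with
nearly the same block sums are counted by binomial coefficients. These fillings have various
margins, but only exp(O(n log n)) of them, and among margins with given block sums the block
constant ones have the most tables. The last claim follows from unit transfers between two columns
and the unimodality of the coefficients of ∏ (1 + X + ... + X^(s i)). -/

namespace ContingencyTable

/-! ### Unimodality of the number of bounded vectors with given sum -/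

section Unimodal

open Polynomial

/-- The coefficients of a polynomial, extended by zero to negative indices. -/
def intCoeff (P : ℕ[X]) (t : ℤ) : ℕ := if 0 ≤ t then P.coeff t.toNat else 0

/-- `P` is symmetric with respect to `S / 2` and its coefficients decrease beyond `S / 2`. -/
structure IsSymmUnimodal (P : ℕ[X]) (S : ℕ) : Prop where
  symm : ∀ t : ℤ, intCoeff P (S - t) = intCoeff P t
  step : ∀ t : ℤ, (S : ℤ) + 1 ≤ 2 * t → intCoeff P t ≤ intCoeff P (t - 1)

lemma isSymmUnimodal_one : IsSymmUnimodal 1 0 := by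
  have h : ∀ t : ℤ, intCoeff 1 t = if t = 0 then 1 else 0 := by
    intro t
    unfold intCoeff
    rw [Polynomial.coeff_one]
    split_ifs <;> first | rfl | omega
  refine ⟨fun t => ?_, fun t ht => ?_⟩
  · simp [h]
  · rw [h, if_neg (by push_cast at ht; omega)]
    exact Nat.zero_le _

lemma IsSymmUnimodal.le_of_add {P : ℕ[X]} {S : ℕ} (h : IsSymmUnimodal P S) {v : ℤ}
    (hv : (S : ℤ) ≤ 2 * v + 1) (d : ℕ) : intCoeff P (v + d) ≤ intCoeff P v := by
  induction d with
  | zero => simp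
  | succ d ih =>
    refine le_trans ?_ ih
    have := h.step (v + (d + 1 : ℕ)) (by push_cast; omega)
    rwa [show v + ((d + 1 : ℕ) : ℤ) - 1 = v + d by push_cast; ring] at this

lemma intCoeff_mul_geom (P : ℕ[X]) (s : ℕ) (t : ℤ) :
    intCoeff (P * ∑ x ∈ Finset.range (s + 1), X ^ x) t =
      ∑ x ∈ Finset.range (s + 1), intCoeff P (t - x) := by
  unfold intCoeff
  split_ifs with ht
  · rw [Finset.mul_sum, Polynomial.finsetSum_coeff]
    refine Finset.sum_congr rfl fun x _ => ?_
    rw [Polynomial.coeff_mul_X_pow']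
    split_ifs with h1 h2 h2
    · congr 1; omega
    · omega
    · omega
    · rfl
  · symm
    refine Finset.sum_eq_zero fun x _ => ?_
    rw [if_neg (by omega)]

/-- The new coefficients are window sums of the old ones, so consecutive ones differ by P(t) -
P(t-1-s). If t-1-s is not yet past the centre, it is reflected to S-(t-1-s), which is still at most
t because S+s+1 ≤ 2t. -/
lemma IsSymmUnimodal.mul_geom {P : ℕ[X]} {S : ℕ} (h : IsSymmUnimodal P S) (s : ℕ) :
    IsSymmUnimodal (P * ∑ x ∈ Finset.range (s + 1), X ^ x) (S + s) := by
  refine ⟨fun t => ?_, fun t ht => ?_⟩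
  · rw [intCoeff_mul_geom, intCoeff_mul_geom, ← Finset.sum_range_reflect]
    refine Finset.sum_congr rfl fun x hx => ?_
    rw [Finset.mem_range] at hx
    rw [← h.symm]
    congr 1
    have : ((s + 1 - 1 - x : ℕ) : ℤ) = s - x := by omega
    rw [this]
    push_cast
    ring
  · rw [intCoeff_mul_geom, intCoeff_mul_geom, Finset.sum_range_succ', Finset.sum_range_succ]
    have e : ∀ x : ℕ, t - ((x + 1 : ℕ) : ℤ) = t - 1 - x := fun x => by push_cast; ring
    simp only [e]
    refine Nat.add_le_add_left ?_ _
    push_cast at ht ⊢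
    rw [sub_zero]
    by_cases hc : (S : ℤ) ≤ 2 * (t - 1 - s) + 1
    · have := h.le_of_add hc (s + 1)
      rwa [show t - 1 - (s : ℤ) + ((s + 1 : ℕ) : ℤ) = t by push_cast; ring] at this
    · rw [← h.symm (t - 1 - s)]
      obtain ⟨d, hd⟩ : ∃ d : ℕ, (d : ℤ) = t - (S - (t - 1 - s)) :=
        ⟨(t - (S - (t - 1 - s))).toNat, by omega⟩
      have := h.le_of_add (v := S - (t - 1 - s)) (by omega) d
      rwa [hd, add_sub_cancel] at this

variable {ι κ : Type*} [Fintype ι] [Fintype κ]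

/-- The vectors of natural numbers bounded by `s` with sum `t`. -/
def boundedVectors [DecidableEq ι] (s : ι → ℕ) (t : ℕ) : Finset (ι → ℕ) :=
  {x ∈ Fintype.piFinset fun i => Finset.range (s i + 1) | ∑ i, x i = t}

lemma card_boundedVectors [DecidableEq ι] (s : ι → ℕ) (t : ℕ) :
    (boundedVectors s t).card =
      (∏ i, ∑ x ∈ Finset.range (s i + 1), (X : ℕ[X]) ^ x).coeff t := by
  rw [Finset.prod_univ_sum, Polynomial.finsetSum_coeff, boundedVectors, Finset.card_filter]
  refine Finset.sum_congr rfl fun x _ => ?_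
  rw [Finset.prod_pow_eq_pow_sum, Polynomial.coeff_X_pow]
  simp only [eq_comm]

lemma isSymmUnimodal_prod_geom (s : ι → ℕ) :
    IsSymmUnimodal (∏ i, ∑ x ∈ Finset.range (s i + 1), (X : ℕ[X]) ^ x) (∑ i, s i) := by
  classical
  induction (Finset.univ : Finset ι) using Finset.induction_on with
  | empty => simpa using isSymmUnimodal_one
  | insert a u ha ih =>
    rw [Finset.prod_insert ha, Finset.sum_insert ha,
      mul_comm (∑ x ∈ Finset.range (s a + 1), (X : ℕ[X]) ^ x), add_comm (s a) (∑ i ∈ u, s i)]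
    exact ih.mul_geom _

lemma card_boundedVectors_le [DecidableEq ι] (s : ι → ℕ) (t : ℕ) (h : ∑ i, s i ≤ 2 * t + 1) :
    (boundedVectors s (t + 1)).card ≤ (boundedVectors s t).card := by
  have := (isSymmUnimodal_prod_geom s).step ((t + 1 : ℕ) : ℤ) (by omega)
  rw [card_boundedVectors, card_boundedVectors]
  rwa [show ((t + 1 : ℕ) : ℤ) - 1 = t by push_cast; ring, intCoeff, intCoeff,
    if_pos (Int.natCast_nonneg _), if_pos (Int.natCast_nonneg _), Int.toNat_natCast,
    Int.toNat_natCast] at this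

end Unimodal

/-! ### Block constant margins maximize the number of tables -/

section Smoothing

variable {ι κ : Type*} [Fintype ι] [Fintype κ]

lemma tables_finite (r : ι → ℕ) (c : κ → ℕ) : (tables r c).Finite := by
  classical
  refine (Set.Finite.pi' (t := fun i => {x : κ → ℕ | ∀ j, x j ∈ Set.Iic (r i)})
    fun i => Set.Finite.pi' fun j => Set.finite_Iic _).subset ?_
  intro M hM i j
  have := hM.1 i
  show M i j ≤ r i
  rw [← this]
  exact Finset.single_le_sum (f := fun j => M i j) (fun _ _ => Nat.zero_le _) (Finset.mem_univ j)

lemma tables_transpose (r : ι → ℕ) (c : κ → ℕ) :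
    (tables r c).ncard = (tables c r).ncard := by
  have h : tables c r = (fun M j i => M i j) '' tables r c := by
    ext M
    constructor
    · intro hM
      exact ⟨fun i j => M j i, ⟨hM.2, hM.1⟩, rfl⟩
    · rintro ⟨N, hN, rfl⟩
      exact ⟨hN.2, hN.1⟩
  rw [h, Set.ncard_image_of_injective]
  intro M N hMN
  funext i j
  exact congrFun (congrFun hMN j) i

/-- Add column `j'` to column `j` and empty column `j'`. -/
def mergeColumns [DecidableEq κ] (j j' : κ) (M : ι → κ → ℕ) : ι → κ → ℕ :=
  fun i l => if l = j then M i j + M i j' else if l = j' then 0 else M i l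

lemma sum_eq_pair_add [DecidableEq κ] {j j' : κ} (hne : j ≠ j') (f : κ → ℕ) :
    ∑ l, f l = f j + f j' + ∑ l ∈ (Finset.univ.erase j).erase j', f l := by
  rw [← Finset.add_sum_erase _ _ (Finset.mem_univ j),
    ← Finset.add_sum_erase _ _ (show j' ∈ Finset.univ.erase j by simp [hne.symm]), add_assoc]

lemma sum_congr_pair [DecidableEq κ] {j j' : κ} (hne : j ≠ j') {f g : κ → ℕ}
    (h1 : f j + f j' = g j + g j') (h2 : ∀ l, l ≠ j → l ≠ j' → f l = g l) :
    ∑ l, f l = ∑ l, g l := by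
  rw [sum_eq_pair_add hne, sum_eq_pair_add hne g, h1]
  congr 1
  refine Finset.sum_congr rfl fun l hl => ?_
  simp only [Finset.mem_erase, Finset.mem_univ, and_true] at hl
  exact h2 l hl.2 hl.1

/-- A table amounts to its merged table K together with column j, which may be any vector bounded by
column j of K with sum `c j`. Column j' is the remainder. -/
lemma ncard_tables_eq_sum [DecidableEq ι] [DecidableEq κ] (r : ι → ℕ) (c d : κ → ℕ) {j j' : κ}
    (hne : j ≠ j') (hj : d j = c j + c j') (hj' : d j' = 0)
    (hd : ∀ l, l ≠ j → l ≠ j' → d l = c l) :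
    (tables r c).ncard =
      ∑ K ∈ (tables_finite r d).toFinset, (boundedVectors (fun i => K i j) (c j)).card := by
  rw [Set.ncard_eq_toFinset_card _ (tables_finite r c)]
  have hmaps : ∀ M ∈ (tables_finite r c).toFinset,
      mergeColumns j j' M ∈ (tables_finite r d).toFinset := by
    intro M hM
    rw [Set.Finite.mem_toFinset] at hM ⊢
    refine ⟨fun i => ?_, fun l => ?_⟩
    · rw [← hM.1 i]
      refine sum_congr_pair hne ?_ fun l h1 h2 => ?_
      · simp [mergeColumns, hne.symm]
      · simp [mergeColumns, h1, h2]
    · by_cases h1 : l = j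
      · subst h1
        simp [mergeColumns, Finset.sum_add_distrib, hM.2, hj]
      · by_cases h2 : l = j'
        · subst h2
          simp [mergeColumns, h1, hj']
        · simp [mergeColumns, h1, h2, hM.2, hd l h1 h2]
  rw [Finset.card_eq_sum_card_fiberwise hmaps]
  refine Finset.sum_congr rfl fun K hK => ?_
  rw [Set.Finite.mem_toFinset] at hK
  have hK0 : ∀ i, K i j' = 0 := by
    have := hK.2 j'
    rw [hj', Finset.sum_eq_zero_iff] at this
    exact fun i => this i (Finset.mem_univ i)
  refine Finset.card_nbij' (fun M i => M i j)
    (fun x i l => if l = j then x i else if l = j' then K i j - x i else K i l) ?_ ?_ ?_ ?_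
  · intro M hM
    simp only [Finset.coe_filter, Set.mem_ofPred_eq, Set.Finite.mem_toFinset] at hM
    obtain ⟨hM, rfl⟩ := hM
    simp only [boundedVectors, Finset.coe_filter, Set.mem_ofPred_eq, Fintype.mem_piFinset,
      Finset.mem_range]
    refine ⟨fun i => ?_, hM.2 j⟩
    simp only [mergeColumns, if_true]
    omega
  · intro x hx
    simp only [boundedVectors, Finset.coe_filter, Set.mem_ofPred_eq, Fintype.mem_piFinset,
      Finset.mem_range] at hx
    obtain ⟨hx, hsum⟩ := hx
    have hx' : ∀ i, x i ≤ K i j := fun i => Nat.lt_succ_iff.1 (hx i)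
    simp only [Finset.coe_filter, Set.mem_ofPred_eq, Set.Finite.mem_toFinset]
    refine ⟨⟨fun i => ?_, fun l => ?_⟩, ?_⟩
    · rw [← hK.1 i]
      refine sum_congr_pair hne ?_ fun l h1 h2 => ?_
      · simp [hne.symm, hK0, hx' i]
      · simp [h1, h2]
    · by_cases h1 : l = j
      · subst h1
        simp [hsum]
      · by_cases h2 : l = j'
        · subst h2
          simp only [h1, if_false, if_true]
          have h3 : ∑ i, (K i j - x i) + ∑ i, x i = ∑ i, K i j := by
            rw [← Finset.sum_add_distrib]
            exact Finset.sum_congr rfl fun i _ => Nat.sub_add_cancel (hx' i)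
          rw [hsum, hK.2 j, hj] at h3
          omega
        · simp [h1, h2, hK.2, hd l h1 h2]
    · funext i l
      simp only [mergeColumns, hne.symm, if_true, if_false]
      split_ifs with h1 h2
      · subst h1
        have := hx' i
        omega
      · subst h2
        exact (hK0 i).symm
      · rfl
  · intro M hM
    simp only [Finset.coe_filter, Set.mem_ofPred_eq, Set.Finite.mem_toFinset] at hM
    obtain ⟨hM, rfl⟩ := hM
    funext i l
    simp only [mergeColumns, if_true]
    split_ifs with h1 h2
    · rw [h1]
    · rw [h2]; omega
    · rfl
  · intro x hx
    simp

/-- Moving a unit from column j to column j' leaves the merged margin d unchanged, so the two counts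
are compared for each merged table. There `c' j` is closer to the centre of a symmetric unimodal
sequence than `c j`. -/
lemma ncard_tables_le_of_transfer (r : ι → ℕ) (c c' : κ → ℕ) {j j' : κ} (hne : j ≠ j')
    (hj : c j = c' j + 1) (hj' : c' j' = c j' + 1) (hle : c' j' ≤ c j)
    (hc : ∀ l, l ≠ j → l ≠ j' → c' l = c l) :
    (tables r c).ncard ≤ (tables r c').ncard := by
  classical
  set d : κ → ℕ := fun l => if l = j then c j + c j' else if l = j' then 0 else c l with hd
  rw [ncard_tables_eq_sum r c d hne (by simp [hd]) (by simp [hd, hne.symm])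
      (fun l h1 h2 => by simp [hd, h1, h2]),
    ncard_tables_eq_sum r c' d hne (by simp [hd]; omega) (by simp [hd, hne.symm])
      (fun l h1 h2 => by simp [hd, h1, h2, hc l h1 h2])]
  refine Finset.sum_le_sum fun K hK => ?_
  rw [Set.Finite.mem_toFinset] at hK
  rw [hj]
  refine card_boundedVectors_le _ _ ?_
  rw [hK.2 j]
  simp only [hd, if_true]
  omega

/-- Among column margins with given sums over the blocks `{j | p j = b}`, the margin that is
constant on each block has the most tables. -/
lemma ncard_tables_le_of_blockSum {B : Type*} [DecidableEq B] (p : κ → B) (r : ι → ℕ)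
    (c c₀ : κ → ℕ) (hconst : ∀ j j', p j = p j' → c₀ j = c₀ j')
    (hsum : ∀ b, ∑ j with p j = b, c j = ∑ j with p j = b, c₀ j) :
    (tables r c).ncard ≤ (tables r c₀).ncard := by
  classical
  obtain ⟨D, hD⟩ : ∃ D, D = ∑ j, ((c j - c₀ j) + (c₀ j - c j)) := ⟨_, rfl⟩
  induction D using Nat.strong_induction_on generalizing c with
  | _ D ih =>
  by_cases hcc : ∀ j, c j ≤ c₀ j
  · have : c = c₀ := by
      funext j
      have h1 := hsum (p j)
      rw [Finset.sum_eq_sum_iff_of_le fun i _ => hcc i] at h1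
      exact h1 j (by simp)
    rw [this]
  · push Not at hcc
    obtain ⟨j, hj⟩ := hcc
    -- Equal block sums force a deficit in the block that contains an excess. As `c₀` is constant on
    -- the block, `c j` exceeds `c j'` by at least 2, and the transfer lowers the ℓ¹ distance to
    -- `c₀`.
    obtain ⟨j', hpj', hj'⟩ : ∃ j', p j' = p j ∧ c j' < c₀ j' := by
      by_contra! hcon
      have := Finset.sum_lt_sum (s := Finset.univ.filter fun l => p l = p j) (f := c₀) (g := c)
        (fun l hl => hcon l (by simpa using hl)) ⟨j, by simp, hj⟩
      rw [hsum] at this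
      exact lt_irrefl _ this
    have hne : j ≠ j' := by rintro rfl; omega
    have hcj := hconst j j' hpj'.symm
    set c' : κ → ℕ := fun l => if l = j then c j - 1 else if l = j' then c j' + 1 else c l with hc'
    have e1 : c' j = c j - 1 := by simp [hc']
    have e2 : c' j' = c j' + 1 := by simp [hc', hne.symm]
    have e3 : ∀ l, l ≠ j → l ≠ j' → c' l = c l := fun l h1 h2 => by simp [hc', h1, h2]
    refine (ncard_tables_le_of_transfer r c c' hne (by omega) e2 (by omega) e3).trans ?_
    refine ih _ ?_ c' (fun b => ?_) rfl
    · rw [hD, sum_eq_pair_add hne, sum_eq_pair_add hne, e1, e2]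
      have : ∑ l ∈ (Finset.univ.erase j).erase j', ((c' l - c₀ l) + (c₀ l - c' l)) =
          ∑ l ∈ (Finset.univ.erase j).erase j', ((c l - c₀ l) + (c₀ l - c l)) := by
        refine Finset.sum_congr rfl fun l hl => ?_
        simp only [Finset.mem_erase, Finset.mem_univ, and_true] at hl
        rw [e3 l hl.2 hl.1]
      rw [this]
      omega
    · rw [← hsum b, Finset.sum_filter, Finset.sum_filter]
      refine sum_congr_pair hne ?_ fun l h1 h2 => by rw [e3 l h1 h2]
      rw [e1, e2, hpj']
      split_ifs <;> omega

end Smoothing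

/-! ### Entropy estimates and crude Stirling bounds -/

section Entropy

lemma entropyFun_zero : entropyFun 0 = 0 := by simp [entropyFun]

lemma monotoneOn_entropyFun : MonotoneOn entropyFun (Set.Ici 0) := by
  refine monotoneOn_of_deriv_nonneg (convex_Ici 0) continuous_entropyFun.continuousOn ?_ ?_
  · rw [interior_Ici]
    exact fun x hx => (hasDerivAt_entropyFun hx).differentiableAt.differentiableWithinAt
  · rw [interior_Ici]
    intro x hx
    have hx : 0 < x := hx
    rw [(hasDerivAt_entropyFun hx).deriv, sub_nonneg]
    exact Real.log_le_log hx (by linarith)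

lemma entropyFun_mul_le {t x : ℝ} (ht₀ : 0 ≤ t) (ht₁ : t ≤ 1) (hx : 0 ≤ x) :
    t * entropyFun x ≤ entropyFun (t * x) := by
  have := strictConcaveOn_entropyFun.concaveOn.2 (x := x) (y := 0) hx (Set.mem_Ici.2 le_rfl) ht₀
    (sub_nonneg.2 ht₁) (by ring)
  simpa [entropyFun_zero] using this

/-- A concave function vanishing at 0 is subadditive: both a and b are fractions of a + b. -/
lemma entropyFun_add_le {a b : ℝ} (ha : 0 ≤ a) (hb : 0 ≤ b) :
    entropyFun (a + b) ≤ entropyFun a + entropyFun b := by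
  rcases (add_nonneg ha hb).eq_or_lt with h | h
  · have h1 : a = 0 := by linarith
    have h2 : b = 0 := by linarith
    simp [h1, h2, entropyFun_zero]
  · have h1 := entropyFun_mul_le (t := a / (a + b)) (by positivity)
      (div_le_one_of_le₀ (by linarith) h.le) h.le
    have h2 := entropyFun_mul_le (t := b / (a + b)) (by positivity)
      (div_le_one_of_le₀ (by linarith) h.le) h.le
    rw [div_mul_cancel₀ _ h.ne'] at h1 h2
    calc entropyFun (a + b) = a / (a + b) * entropyFun (a + b) + b / (a + b) * entropyFun (a + b) := by
          field_simp
      _ ≤ _ := add_le_add h1 h2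

/-- This is the form in which Stirling's formula produces the entropy: the right side is the main
term of log((x+y)! / (x! y!)). -/
lemma mul_entropyFun_div {x y : ℝ} (hx : 0 ≤ x) (hy : 0 < y) :
    y * entropyFun (x / y) =
      (x + y) * Real.log (x + y) - x * Real.log x - y * Real.log y := by
  have h1 : x / y + 1 = (x + y) / y := by field_simp
  rw [entropyFun, h1, Real.log_div (by positivity) hy.ne']
  rcases hx.eq_or_lt with rfl | hx
  · simp
  · rw [Real.log_div hx.ne' hy.ne']
    field_simp
    ring

lemma mul_entropyFun_inv_le {y : ℝ} (hy : 0 < y) :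
    y * entropyFun (1 / y) ≤ Real.log (y + 1) + 1 := by
  rw [mul_entropyFun_div zero_le_one hy, Real.log_one, add_comm 1 y]
  have h : Real.log ((y + 1) / y) ≤ (y + 1) / y - 1 := Real.log_le_sub_one_of_pos (by positivity)
  rw [Real.log_div (by positivity) hy.ne'] at h
  have h2 : y * (Real.log (y + 1) - Real.log y) ≤ y * ((y + 1) / y - 1) :=
    mul_le_mul_of_nonneg_left h hy.le
  have h3 : y * ((y + 1) / y - 1) = 1 := by field_simp; ring
  linarith

/-- Rounding the block sum `x` down costs a logarithmic amount of entropy. -/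
lemma mul_entropyFun_div_le_of_sub_one_le {x t y : ℝ} (hx : 0 ≤ x) (ht : 0 ≤ t) (hy : 0 < y)
    (hxt : x ≤ t + 1) :
    y * entropyFun (x / y) ≤ y * entropyFun (t / y) + Real.log (y + 1) + 1 := by
  have h1 : entropyFun (x / y) ≤ entropyFun (t / y + 1 / y) := by
    refine monotoneOn_entropyFun (Set.mem_Ici.2 (by positivity))
      (Set.mem_Ici.2 (by positivity)) ?_
    rw [← add_div]
    gcongr
  have h2 := h1.trans (entropyFun_add_le (a := t / y) (b := 1 / y) (by positivity) (by positivity))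
  have h3 := mul_le_mul_of_nonneg_left h2 hy.le
  have h4 := mul_entropyFun_inv_le hy
  linarith

lemma sum_entropyFun_le {α : Type*} (s : Finset α) (hs : s.Nonempty) (z : α → ℝ)
    (hz : ∀ a ∈ s, 0 ≤ z a) :
    ∑ a ∈ s, entropyFun (z a) ≤ (s.card : ℝ) * entropyFun ((∑ a ∈ s, z a) / s.card) := by
  have hc : (0 : ℝ) < s.card := by exact_mod_cast hs.card_pos
  have := strictConcaveOn_entropyFun.concaveOn.le_map_sum (t := s) (w := fun _ => (s.card : ℝ)⁻¹)
    (p := z) (fun _ _ => by positivity) (by simp [hc.ne']) (fun a ha => hz a ha)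
  simp only [smul_eq_mul, ← Finset.mul_sum] at this
  rw [← div_eq_inv_mul, div_le_iff₀ hc, ← div_eq_inv_mul] at this
  linarith

/-- The induction step amounts to (n+2) log((n+2)/(n+1)) ≥ 1. -/
lemma log_factorial_le (n : ℕ) :
    Real.log n.factorial ≤ n * Real.log n - n + Real.log (n + 1) + 1 := by
  have key : ∀ n : ℕ, Real.log (n + 1).factorial ≤
      (n + 2) * Real.log (n + 1) - (n + 1) + 1 := by
    intro n
    induction n with
    | zero => simp
    | succ n ih =>
      rw [Nat.factorial_succ, Nat.cast_mul, Real.log_mul (by positivity) (by positivity)]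
      have h : 1 - ((n + 2 : ℝ) / (n + 1))⁻¹ ≤ Real.log ((n + 2 : ℝ) / (n + 1)) :=
        Real.one_sub_inv_le_log_of_pos (by positivity)
      rw [Real.log_div (by positivity) (by positivity)] at h
      have h2 : (n + 2 : ℝ) * (1 - ((n + 2 : ℝ) / (n + 1))⁻¹) = 1 := by field_simp; ring
      have h3 := mul_le_mul_of_nonneg_left h (by positivity : (0 : ℝ) ≤ n + 2)
      push_cast
      have e : (n : ℝ) + 1 + 1 = n + 2 := by ring
      rw [e]
      linarith
  cases n with
  | zero => simp
  | succ n =>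
    have h1 := key n
    have h2 : Real.log ((n : ℝ) + 1) ≤ Real.log ((n : ℝ) + 1 + 1) :=
      Real.log_le_log (by positivity) (by linarith)
    push_cast
    linarith

/-- n^n / n! is a single term of the series of exp(n). -/
lemma le_log_factorial (n : ℕ) : n * Real.log n - n ≤ Real.log n.factorial := by
  rcases Nat.eq_zero_or_pos n with rfl | hn
  · simp
  · have hn' : (0 : ℝ) < n := by exact_mod_cast hn
    have h := Real.pow_div_factorial_le_exp (x := n) hn'.le n
    have h2 := Real.log_le_log (by positivity) h
    rw [Real.log_exp, Real.log_div (by positivity) (by positivity), Real.log_pow] at h2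
    linarith

/-- The binomial coefficient equals (K+T)! / (K! T!) · K/(K+T). The errors of the two factorials in
the denominator and the factor K+T each cost one logarithm. -/
lemma le_log_choose {K : ℕ} (hK : 0 < K) (T : ℕ) :
    K * entropyFun ((T : ℝ) / K) - 3 * Real.log (K + T + 1) - 2 ≤
      Real.log ((K + T - 1).choose T) := by
  have hK' : (1 : ℝ) ≤ K := by exact_mod_cast hK
  obtain ⟨k, rfl⟩ : ∃ k, K = k + 1 := ⟨K - 1, by omega⟩
  have e : k + 1 + T - 1 = k + T := by omega
  rw [e, mul_entropyFun_div (Nat.cast_nonneg T) (by positivity)]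
  have h1 : ((k + T).choose T : ℝ) * (T.factorial * (k + 1).factorial) * (k + 1 + T) =
      (k + 1 + T).factorial * (k + 1) := by
    have h2 : (k + T).choose T * T.factorial * k.factorial = (k + T).factorial := by
      have := Nat.choose_mul_factorial_mul_factorial (Nat.le_add_left T k)
      rwa [Nat.add_sub_cancel] at this
    have h3 : (k + 1 + T).factorial = (k + 1 + T) * (k + T).factorial := by
      rw [show k + 1 + T = (k + T) + 1 by ring, Nat.factorial_succ]
    rw [h3, ← h2, Nat.factorial_succ]
    push_cast
    ring
  have hch : (0 : ℝ) < (k + T).choose T := by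
    exact_mod_cast Nat.choose_pos (Nat.le_add_left T k)
  have h4 := congrArg Real.log h1
  rw [Real.log_mul (by positivity) (by positivity), Real.log_mul (by positivity) (by positivity),
    Real.log_mul (by positivity) (by positivity), Real.log_mul (by positivity) (by positivity)] at h4
  have a1 := le_log_factorial (k + 1 + T)
  have a2 := log_factorial_le T
  have a3 := log_factorial_le (k + 1)
  have b1 : Real.log (T + 1) ≤ Real.log ((k : ℝ) + 1 + T + 1) :=
    Real.log_le_log (by positivity) (by linarith [Nat.cast_nonneg (α := ℝ) k])
  have b2 : Real.log ((k : ℝ) + 1 + 1) ≤ Real.log ((k : ℝ) + 1 + T + 1) :=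
    Real.log_le_log (by positivity) (by linarith [Nat.cast_nonneg (α := ℝ) T])
  have b3 : Real.log ((k : ℝ) + 1 + T) ≤ Real.log ((k : ℝ) + 1 + T + 1) :=
    Real.log_le_log (by positivity) (by linarith)
  have b4 : 0 ≤ Real.log ((k : ℝ) + 1) := Real.log_nonneg (by linarith [Nat.cast_nonneg (α := ℝ) k])
  push_cast at a1 a2 a3 h4 ⊢
  have e1 : (T : ℝ) + (k + 1) = k + 1 + T := by ring
  rw [e1]
  linarith

end Entropy

/-! ### Counting tables with prescribed block sums -/

section Counting

variable {ι κ : Type*} [Fintype ι] [Fintype κ] {B B' : Type*}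
  [DecidableEq B] [DecidableEq B']

/-- The positions of a table in the block `(b.1, b.2)`. -/
def block (p : ι → B) (q : κ → B') (b : B × B') : Finset (ι × κ) :=
  {x | p x.1 = b.1 ∧ q x.2 = b.2}

lemma mem_block {p : ι → B} {q : κ → B'} {b : B × B'} {x : ι × κ} :
    x ∈ block p q b ↔ (p x.1, q x.2) = b := by
  simp [block, Prod.ext_iff]

lemma sum_block {M : Type*} [AddCommMonoid M] (p : ι → B) (q : κ → B') (b : B) (b' : B')
    (f : ι → κ → M) :
    ∑ x ∈ block p q (b, b'), f x.1 x.2 = ∑ i with p i = b, ∑ j with q j = b', f i j := by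
  rw [← Finset.sum_product']
  refine Finset.sum_congr ?_ fun _ _ => rfl
  ext x
  simp [block]

/-- The columns are smoothed with the rows fixed, then the rows by transposition. -/
lemma ncard_tables_le_of_blockSums (p : ι → B) (q : κ → B') (r r₀ : ι → ℕ) (c c₀ : κ → ℕ)
    (hr : ∀ i i', p i = p i' → r₀ i = r₀ i') (hc : ∀ j j', q j = q j' → c₀ j = c₀ j')
    (hrs : ∀ b, ∑ i with p i = b, r i = ∑ i with p i = b, r₀ i)
    (hcs : ∀ b, ∑ j with q j = b, c j = ∑ j with q j = b, c₀ j) :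
    (tables r c).ncard ≤ (tables r₀ c₀).ncard := by
  refine (ncard_tables_le_of_blockSum q r c c₀ hc hcs).trans ?_
  rw [tables_transpose, tables_transpose r₀]
  exact ncard_tables_le_of_blockSum p c₀ r r₀ hr hrs

lemma sum_rows_eq_sum_blocks [Fintype B'] {M : Type*} [AddCommMonoid M] (p : ι → B) (q : κ → B') (b : B)
    (f : ι → κ → M) :
    ∑ i with p i = b, ∑ j, f i j = ∑ b', ∑ x ∈ block p q (b, b'), f x.1 x.2 := by
  simp only [sum_block]
  refine Eq.trans ?_ Finset.sum_comm
  exact Finset.sum_congr rfl fun i _ => (Finset.sum_fiberwise Finset.univ q (f i)).symm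

variable [Fintype B]

lemma sum_columns_eq_sum_blocks {M : Type*} [AddCommMonoid M] (p : ι → B) (q : κ → B') (b' : B')
    (f : ι → κ → M) :
    ∑ j with q j = b', ∑ i, f i j = ∑ b, ∑ x ∈ block p q (b, b'), f x.1 x.2 := by
  simp only [sum_block]
  rw [Finset.sum_comm, ← Finset.sum_fiberwise Finset.univ p (fun i => ∑ j with q j = b', f i j)]

variable [Fintype B']

lemma sum_eq_sum_blocks {M : Type*} [AddCommMonoid M] (p : ι → B) (q : κ → B')
    (f : ι → κ → M) :
    ∑ i, ∑ j, f i j = ∑ b, ∑ x ∈ block p q b, f x.1 x.2 := by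
  rw [← Finset.sum_fiberwise Finset.univ p (fun i => ∑ j, f i j), Fintype.sum_prod_type]
  exact Finset.sum_congr rfl fun b _ => sum_rows_eq_sum_blocks p q b f

lemma card_piAntidiag {α : Type*} [DecidableEq α] (s : Finset α) (n : ℕ) :
    (s.piAntidiag n).card = (s.card + n - 1).choose n := by
  rw [← Finset.card_finsuppAntidiag_nat_eq_choose, Finset.finsuppAntidiag, Finset.card_map,
    Finset.card_attach]

/-- Up to the number of possible margins, the tables with block constant margins are at least
as many as the tables with compatible block sums. -/
lemma prod_choose_le_ncard_tables (p : ι → B) (q : κ → B') (r : ι → ℕ) (c : κ → ℕ)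
    (hr : ∀ i i', p i = p i' → r i = r i') (hc : ∀ j j', q j = q j' → c j = c j')
    (T : B × B' → ℕ)
    (hTr : ∀ b, ∑ b', T (b, b') = ∑ i with p i = b, r i)
    (hTc : ∀ b', ∑ b, T (b, b') = ∑ j with q j = b', c j) :
    ∏ b, ((block p q b).card + T b - 1).choose (T b) ≤
      (tables r c).ncard * (∑ b, T b + 1) ^ (Fintype.card ι + Fintype.card κ) := by
  classical
  set G : Finset (B × B' → ι × κ → ℕ) :=
    Fintype.piFinset fun b => (block p q b).piAntidiag (T b) with hG
  have hGcard : G.card = ∏ b, ((block p q b).card + T b - 1).choose (T b) := by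
    rw [hG, Fintype.card_piFinset]
    exact Finset.prod_congr rfl fun b _ => card_piAntidiag _ _
  have hGmem : ∀ u ∈ G, ∀ b, ∑ x ∈ block p q b, u b x = T b ∧ ∀ x, u b x ≠ 0 → x ∈ block p q b := by
    intro u hu b
    exact Finset.mem_piAntidiag.1 (Fintype.mem_piFinset.1 hu b)
  set Φ : (B × B' → ι × κ → ℕ) → ι → κ → ℕ := fun u i j => u (p i, q j) (i, j) with hΦ
  have hΦsum : ∀ u ∈ G, ∀ b, ∑ x ∈ block p q b, Φ u x.1 x.2 = T b := by
    intro u hu b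
    rw [← (hGmem u hu b).1]
    refine Finset.sum_congr rfl fun x hx => ?_
    rw [mem_block] at hx
    simp only [hΦ]
    rw [hx]
  have hinj : ∀ u ∈ G, ∀ v ∈ G, Φ u = Φ v → u = v := by
    intro u hu v hv huv
    funext b x
    by_cases hx : x ∈ block p q b
    · have := congrFun (congrFun huv x.1) x.2
      simp only [hΦ] at this
      rwa [mem_block.1 hx] at this
    · rw [not_imp_comm.1 ((hGmem u hu b).2 x) hx, not_imp_comm.1 ((hGmem v hv b).2 x) hx]
  set N := ∑ b, T b with hN
  set H : Finset ((ι → ℕ) × (κ → ℕ)) :=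
    (Fintype.piFinset fun _ => Finset.range (N + 1)) ×ˢ
      (Fintype.piFinset fun _ => Finset.range (N + 1)) with hH
  have hHcard : H.card = (N + 1) ^ (Fintype.card ι + Fintype.card κ) := by
    rw [hH, Finset.card_product, Fintype.card_piFinset, Fintype.card_piFinset, pow_add]
    simp
  have hΦtot : ∀ u ∈ G, ∑ i, ∑ j, Φ u i j = N := by
    intro u hu
    rw [sum_eq_sum_blocks p q, hN]
    exact Finset.sum_congr rfl fun b _ => hΦsum u hu b
  rw [← hGcard, ← hHcard]
  -- The fillings are sorted by their margins, of which there are at most `H.card`. Those with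
  -- margins (r', c') inject into `tables r' c'`, which smoothing bounds by `tables r c`.
  refine Finset.card_le_mul_card_image_of_maps_to
    (f := fun u => (fun i => ∑ j, Φ u i j, fun j => ∑ i, Φ u i j)) ?_ _ ?_
  · intro u hu
    simp only [hH, Finset.mem_product, Fintype.mem_piFinset, Finset.mem_range, Nat.lt_succ_iff]
    refine ⟨fun i => ?_, fun j => ?_⟩
    · rw [← hΦtot u hu]
      exact Finset.single_le_sum (f := fun i => ∑ j, Φ u i j) (fun _ _ => Nat.zero_le _)
        (Finset.mem_univ i)
    · rw [← hΦtot u hu, Finset.sum_comm]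
      exact Finset.single_le_sum (f := fun j => ∑ i, Φ u i j) (fun _ _ => Nat.zero_le _)
        (Finset.mem_univ j)
  · rintro ⟨r', c'⟩ -
    -- A member of the fibre is needed to know that (r', c') has the block sums of (r, c).
    rcases Finset.eq_empty_or_nonempty
      {u ∈ G | (fun i => ∑ j, Φ u i j, fun j => ∑ i, Φ u i j) = (r', c')} with h0 | ⟨u₀, hu₀⟩
    · rw [h0]; simp
    · rw [Finset.mem_filter, Prod.mk.injEq] at hu₀
      obtain ⟨hu₀, hr', hc'⟩ := hu₀
      refine le_trans ?_ (ncard_tables_le_of_blockSums p q r' r c' c hr hc ?_ ?_)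
      · rw [Set.ncard_eq_toFinset_card _ (tables_finite r' c')]
        refine Finset.card_le_card_of_injOn Φ ?_ ?_
        · intro u hu
          simp only [Finset.coe_filter, Set.mem_ofPred_eq, Prod.mk.injEq] at hu
          rw [Finset.mem_coe, Set.Finite.mem_toFinset]
          exact ⟨fun i => congrFun hu.2.1 i, fun j => congrFun hu.2.2 j⟩
        · intro u hu v hv huv
          simp only [Finset.coe_filter, Set.mem_ofPred_eq] at hu hv
          exact hinj u hu.1 v hv.1 huv
      · intro b
        rw [← hr', sum_rows_eq_sum_blocks p q, ← hTr]
        exact Finset.sum_congr rfl fun b' _ => hΦsum u₀ hu₀ _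
      · intro b'
        rw [← hc', sum_columns_eq_sum_blocks p q, ← hTc]
        exact Finset.sum_congr rfl fun b _ => hΦsum u₀ hu₀ _

end Counting

/-! ### The entropy gap for block margins -/

section LowerBound

/-- On each block Jensen replaces Z by its average, the passage from the block sum to the integer T
costs L + 1, and the Stirling bound for the binomial coefficient costs 3L + 2. -/
lemma tableEntropy_le_of_blockSums {ι κ B B' : Type*} [Fintype ι] [Fintype κ] [Fintype B]
    [Fintype B'] [DecidableEq B] [DecidableEq B'] (p : ι → B) (q : κ → B')
    (hp : Function.Surjective p) (hq : Function.Surjective q) (r : ι → ℕ) (c : κ → ℕ)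
    (hr : ∀ i i', p i = p i' → r i = r i') (hc : ∀ j j', q j = q j' → c j = c j')
    (T : B × B' → ℕ)
    (hTr : ∀ b, ∑ b', T (b, b') = ∑ i with p i = b, r i)
    (hTc : ∀ b', ∑ b, T (b, b') = ∑ j with q j = b', c j)
    (Z : ι → κ → ℝ) (hZ : ∀ i j, 0 ≤ Z i j)
    (hTZ : ∀ b, ∑ x ∈ block p q b, Z x.1 x.2 ≤ T b + 1) :
    tableEntropy Z ≤ Real.log (tables r c).ncard +
      (Fintype.card ι + Fintype.card κ : ℕ) * Real.log (∑ i, r i + 1 : ℕ) +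
      Fintype.card (B × B') *
        (4 * Real.log (Fintype.card ι * Fintype.card κ + ∑ i, r i + 1 : ℕ) + 3) := by
  classical
  have hTN : ∑ b, T b = ∑ i, r i := by
    rw [Fintype.sum_prod_type, ← Finset.sum_fiberwise Finset.univ p r]
    exact Finset.sum_congr rfl fun b _ => hTr b
  set L := Real.log (Fintype.card ι * Fintype.card κ + ∑ i, r i + 1 : ℕ) with hL
  have hcard := prod_choose_le_ncard_tables p q r c hr hc T hTr hTc
  rw [hTN] at hcard
  have hKpos : ∀ b, 0 < (block p q b).card := by
    intro b
    obtain ⟨i, hi⟩ := hp b.1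
    obtain ⟨j, hj⟩ := hq b.2
    exact Finset.card_pos.2 ⟨(i, j), by simp [block, hi, hj]⟩
  have hch : ∀ b, 0 < ((block p q b).card + T b - 1).choose (T b) := fun b =>
    Nat.choose_pos (by have := hKpos b; omega)
  have hprod := Finset.prod_pos fun b (_ : b ∈ Finset.univ) => hch b
  have hM : 0 < (tables r c).ncard := Nat.pos_of_mul_pos_right (hprod.trans_le hcard)
  have hlog : ∑ b, Real.log (((block p q b).card + T b - 1).choose (T b)) ≤
      Real.log (tables r c).ncard +
      (Fintype.card ι + Fintype.card κ : ℕ) * Real.log (∑ i, r i + 1 : ℕ) := by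
    rw [← Real.log_prod fun b _ => by exact_mod_cast (hch b).ne', ← Real.log_pow,
      ← Real.log_mul (by exact_mod_cast hM.ne') (by positivity)]
    refine Real.log_le_log (by exact_mod_cast hprod) ?_
    exact_mod_cast hcard
  have hblock : ∀ b, ∑ x ∈ block p q b, entropyFun (Z x.1 x.2) ≤
      Real.log (((block p q b).card + T b - 1).choose (T b)) + (4 * L + 3) := by
    intro b
    have hK : (0 : ℝ) < (block p q b).card := by exact_mod_cast hKpos b
    have h1 := sum_entropyFun_le (block p q b) (Finset.card_pos.1 (hKpos b))
      (fun x => Z x.1 x.2) fun x _ => hZ _ _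
    have h2 := mul_entropyFun_div_le_of_sub_one_le
      (Finset.sum_nonneg fun x (_ : x ∈ block p q b) => hZ x.1 x.2) (Nat.cast_nonneg (T b)) hK
      (hTZ b)
    have h3 := le_log_choose (hKpos b) (T b)
    have hTb : T b ≤ ∑ i, r i := by
      rw [← hTN]
      exact Finset.single_le_sum (fun _ _ => Nat.zero_le _) (Finset.mem_univ b)
    have hKb : (block p q b).card ≤ Fintype.card ι * Fintype.card κ := by
      rw [← Fintype.card_prod]
      exact Finset.card_le_univ _
    have h4 : Real.log ((block p q b).card + T b + 1) ≤ L := by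
      refine Real.log_le_log (by positivity) ?_
      exact_mod_cast (by omega : (block p q b).card + T b + 1 ≤
        Fintype.card ι * Fintype.card κ + ∑ i, r i + 1)
    have h5 : Real.log ((block p q b).card + 1) ≤ L := by
      refine Real.log_le_log (by positivity) ?_
      exact_mod_cast (by omega : (block p q b).card + 1 ≤
        Fintype.card ι * Fintype.card κ + ∑ i, r i + 1)
    linarith
  calc tableEntropy Z = ∑ b, ∑ x ∈ block p q b, entropyFun (Z x.1 x.2) :=
        sum_eq_sum_blocks p q fun i j => entropyFun (Z i j)
    _ ≤ ∑ b, (Real.log (((block p q b).card + T b - 1).choose (T b)) + (4 * L + 3)) :=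
        Finset.sum_le_sum fun b _ => hblock b
    _ ≤ _ := by
      rw [Finset.sum_add_distrib, Finset.sum_const, Finset.card_univ, nsmul_eq_mul]
      linarith

/-- For margins with two blocks, `exp (g(Z))` exceeds the number of tables at most by a factor
that is exponential in the number of rows times a logarithm. -/
lemma tableEntropy_le_of_two_blocks {ι : Type*} [Fintype ι] (p : ι → Bool)
    (hp : Function.Surjective p) (r : ι → ℕ) (hr : ∀ i i', p i = p i' → r i = r i')
    (Z : ι → ι → ℝ) (hZ : Z ∈ polytope r r) :
    tableEntropy Z ≤ Real.log (tables r r).ncard +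
      (Fintype.card ι + Fintype.card ι : ℕ) * Real.log (∑ i, r i + 1 : ℕ) +
      4 * (4 * Real.log (Fintype.card ι * Fintype.card ι + ∑ i, r i + 1 : ℕ) + 3) := by
  set S : Bool × Bool → ℝ := fun b => ∑ x ∈ block p p b, Z x.1 x.2 with hS
  set R : Bool → ℕ := fun b => ∑ i with p i = b, r i with hR
  have hS0 : ∀ b, 0 ≤ S b := fun b => Finset.sum_nonneg fun x _ => hZ.1 _ _
  have hrow : ∀ b, S (b, true) + S (b, false) = R b := by
    intro b
    have := sum_rows_eq_sum_blocks p p b Z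
    rw [Fintype.sum_bool] at this
    rw [← this, hR]
    push_cast
    exact Finset.sum_congr rfl fun i _ => hZ.2.1 i
  have hcol : ∀ b, S (true, b) + S (false, b) = R b := by
    intro b
    have := sum_columns_eq_sum_blocks p p b Z
    rw [Fintype.sum_bool] at this
    rw [← this, hR]
    push_cast
    exact Finset.sum_congr rfl fun i _ => hZ.2.2 i
  -- A 2 × 2 matrix of block sums with given margins has one free parameter. Rounding it down fixes
  -- an integer matrix T that is nonnegative and satisfies S ≤ T + 1 entrywise.
  set t := ⌊S (true, true)⌋₊ with ht
  have ht1 : (t : ℝ) ≤ S (true, true) := Nat.floor_le (hS0 _)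
  have ht2 : S (true, true) < t + 1 := Nat.lt_floor_add_one _
  have ht3 : t ≤ R true := by
    have := hrow true
    have := hS0 (true, false)
    exact_mod_cast (by linarith : (t : ℝ) ≤ R true)
  have ht4 : R true ≤ R false + t := by
    have h1 := hrow true
    have h2 := hcol false
    have h3 := hS0 (false, false)
    have : (R true : ℝ) < R false + t + 1 := by linarith
    have : R true < R false + t + 1 := by exact_mod_cast this
    omega
  set T : Bool × Bool → ℕ := fun b =>
    match b with
    | (true, true) => t
    | (true, false) => R true - t
    | (false, true) => R true - t
    | (false, false) => R false + t - R true with hT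
  have hc1 : ((R true - t : ℕ) : ℝ) = R true - t := Nat.cast_sub ht3
  have hc2 : ((R false + t - R true : ℕ) : ℝ) = R false + t - R true := by
    rw [Nat.cast_sub ht4]; push_cast; ring
  have h := tableEntropy_le_of_blockSums p p hp hp r r hr hr T ?_ ?_ Z hZ.1 ?_
  · simpa using h
  · rintro (_ | _) <;> rw [Fintype.sum_bool]
    · show R true - t + (R false + t - R true) = R false
      omega
    · show t + (R true - t) = R true
      omega
  · rintro (_ | _) <;> rw [Fintype.sum_bool]
    · show R true - t + (R false + t - R true) = R false
      omega
    · show t + (R true - t) = R true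
      omega
  · have h1 := hrow true
    have h2 := hrow false
    have h3 := hcol true
    rintro ⟨_ | _, _ | _⟩
    · show S (false, false) ≤ ((R false + t - R true : ℕ) : ℝ) + 1
      rw [hc2]; linarith
    · show S (false, true) ≤ ((R true - t : ℕ) : ℝ) + 1
      rw [hc1]; linarith
    · show S (true, false) ≤ ((R true - t : ℕ) : ℝ) + 1
      rw [hc1]; linarith
    · exact ht2.le

end LowerBound

/-! ### First order condition and transference -/

section Transference

variable {ι κ : Type*} [Fintype ι] [Fintype κ]

/-- Concavity of log at w/z and 1 with weights z/(z+1) and 1/(z+1) gives the claim directly,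
including the boundary point z = 0. -/
lemma entropyFun_le_tangent {z w : ℝ} (hz : 0 ≤ z) (hw : 0 < w) :
    entropyFun z ≤ entropyFun w + (Real.log (w + 1) - Real.log w) * (z - w) := by
  have key : (z + 1) * (Real.log (z + 1) - Real.log (w + 1)) ≤ z * (Real.log z - Real.log w) := by
    rcases hz.eq_or_lt with rfl | hz
    · have := Real.log_nonneg (by linarith : (1 : ℝ) ≤ w + 1)
      simpa using this
    · have := strictConcaveOn_log_Ioi.concaveOn.2
        (show w / z ∈ Set.Ioi 0 from Set.mem_Ioi.2 (by positivity))
        (show (1 : ℝ) ∈ Set.Ioi 0 from Set.mem_Ioi.2 one_pos)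
        (show 0 ≤ z / (z + 1) by positivity) (show 0 ≤ 1 / (z + 1) by positivity) (by field_simp)
      rw [smul_eq_mul, smul_eq_mul, smul_eq_mul, smul_eq_mul, Real.log_one,
        show z / (z + 1) * (w / z) + 1 / (z + 1) * 1 = (w + 1) / (z + 1) by field_simp,
        Real.log_div hw.ne' hz.ne', Real.log_div (by positivity) (by positivity), mul_zero,
        add_zero, div_mul_eq_mul_div, div_le_iff₀ (by positivity)] at this
      linarith
  simp only [entropyFun]
  linarith

variable {r : ι → ℕ} {c : κ → ℕ} {Z : ι → κ → ℝ}

/-- The tangents are taken at a point W between Z and V and compared with Z, because the slope of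
the entropy is infinite at zero entries of Z. An entry of W vanishes only where Z and V both vanish.
-/
lemma sum_deriv_segment_nonpos (hZ : Z ∈ polytope r c)
    (hmax : IsMaxOn tableEntropy (polytope r c) Z) {V : ι → κ → ℝ} (hV : V ∈ polytope r c)
    {t : ℝ} (ht₀ : 0 < t) (ht₁ : t < 1) :
    ∑ i, ∑ j, (Real.log (Z i j + t * (V i j - Z i j) + 1) -
      Real.log (Z i j + t * (V i j - Z i j))) * (V i j - Z i j) ≤ 0 := by
  set W : ι → κ → ℝ := fun i j => Z i j + t * (V i j - Z i j) with hW
  have hWmem : W ∈ polytope r c := by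
    have := polytope_convex r c hZ hV (sub_nonneg.2 ht₁.le) ht₀.le (by ring)
    convert this using 1
    funext i j
    simp only [hW, Pi.add_apply, Pi.smul_apply, smul_eq_mul]
    ring
  have h1 : tableEntropy Z ≤ tableEntropy W +
      ∑ i, ∑ j, (Real.log (W i j + 1) - Real.log (W i j)) * (Z i j - W i j) := by
    simp only [tableEntropy, ← Finset.sum_add_distrib]
    refine Finset.sum_le_sum fun i _ => Finset.sum_le_sum fun j _ => ?_
    rcases (hWmem.1 i j).eq_or_lt with h0 | hpos
    · have hz := hZ.1 i j
      have hv := hV.1 i j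
      have e : W i j = (1 - t) * Z i j + t * V i j := by simp only [hW]; ring
      have h3 : 0 ≤ t * V i j := by positivity
      have h2 : Z i j = 0 := by
        have : (1 - t) * Z i j ≤ 0 := by linarith
        have h4 : 0 < 1 - t := by linarith
        nlinarith
      rw [← h0, h2]
      simp
    · exact entropyFun_le_tangent (hZ.1 i j) hpos
  have h2 : tableEntropy W ≤ tableEntropy Z := hmax hWmem
  have h3 : ∑ i, ∑ j, (Real.log (W i j + 1) - Real.log (W i j)) * (Z i j - W i j) =
      -t * ∑ i, ∑ j, (Real.log (W i j + 1) - Real.log (W i j)) * (V i j - Z i j) := by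
    simp only [Finset.mul_sum]
    refine Finset.sum_congr rfl fun i _ => Finset.sum_congr rfl fun j _ => ?_
    simp only [hW]
    ring
  rw [h3] at h1
  by_contra! hcon
  have := mul_pos ht₀ hcon
  linarith

/-- The alternative v = z is for entries with Z = 0, where the factor v - z removes the value
assigned to log 0. -/
lemma tendsto_deriv_segment {z v : ℝ} (h : 0 < z ∨ v = z) :
    Tendsto (fun t : ℝ => (Real.log (z + t * (v - z) + 1) - Real.log (z + t * (v - z))) * (v - z))
      (nhdsWithin 0 (Set.Ioi 0)) (nhds ((Real.log (z + 1) - Real.log z) * (v - z))) := by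
  rcases h with hz | rfl
  · have hc : ContinuousAt (fun t : ℝ => (Real.log (z + t * (v - z) + 1) -
        Real.log (z + t * (v - z))) * (v - z)) 0 := by
      refine ContinuousAt.mul (ContinuousAt.sub ?_ ?_) continuousAt_const
      · exact ContinuousAt.log (by fun_prop) (by simp; positivity)
      · exact ContinuousAt.log (by fun_prop) (by simp; positivity)
    have := hc.tendsto
    simp only [zero_mul, add_zero] at this
    exact this.mono_left nhdsWithin_le_nhds
  · simp

/-- If V were positive at a zero of Z, the infinite slope at 0 would make the derivative of g along
the segment from Z to V tend to +∞ near Z, against maximality. -/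
lemma eq_zero_of_maximizer_eq_zero (hZ : Z ∈ polytope r c)
    (hmax : IsMaxOn tableEntropy (polytope r c) Z) {V : ι → κ → ℝ} (hV : V ∈ polytope r c)
    {i : ι} {j : κ} (hij : Z i j = 0) : V i j = 0 := by
  classical
  by_contra hne
  have hVpos : 0 < V i j := lt_of_le_of_ne (hV.1 i j) (Ne.symm hne)
  set F : ι × κ → ℝ → ℝ := fun x t => (Real.log (Z x.1 x.2 + t * (V x.1 x.2 - Z x.1 x.2) + 1) -
      Real.log (Z x.1 x.2 + t * (V x.1 x.2 - Z x.1 x.2))) * (V x.1 x.2 - Z x.1 x.2) with hF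
  set G : Finset (ι × κ) := {x | 0 < Z x.1 x.2} with hG
  have hgood : Tendsto (fun t => ∑ x ∈ G, F x t) (nhdsWithin 0 (Set.Ioi 0))
      (nhds (∑ x ∈ G, (Real.log (Z x.1 x.2 + 1) - Real.log (Z x.1 x.2)) *
        (V x.1 x.2 - Z x.1 x.2))) :=
    tendsto_finsetSum _ fun x hx => tendsto_deriv_segment (Or.inl (by simpa [hG] using hx))
  have hbad : Tendsto (F (i, j)) (nhdsWithin 0 (Set.Ioi 0)) atTop := by
    simp only [hF, hij, sub_zero, zero_add]
    refine Tendsto.atTop_mul_const hVpos ?_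
    have h1 : Tendsto (fun t : ℝ => t * V i j) (nhdsWithin 0 (Set.Ioi 0))
        (nhdsWithin 0 (Set.Ioi 0)) := by
      refine tendsto_nhdsWithin_iff.2 ⟨?_, ?_⟩
      · have : Tendsto (fun t : ℝ => t * V i j) (nhds 0) (nhds (0 * V i j)) :=
          (continuous_mul_const _).tendsto 0
        rw [zero_mul] at this
        exact this.mono_left nhdsWithin_le_nhds
      · filter_upwards [self_mem_nhdsWithin] with t ht
        exact mul_pos ht hVpos
    have h2 : Tendsto (fun t : ℝ => -Real.log (t * V i j)) (nhdsWithin 0 (Set.Ioi 0)) atTop :=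
      tendsto_neg_atBot_atTop.comp (Real.tendsto_log_nhdsGT_zero.comp h1)
    refine tendsto_atTop_mono' _ ?_ h2
    filter_upwards [self_mem_nhdsWithin] with t ht
    have ht : 0 < t := ht
    have := Real.log_nonneg (by nlinarith : (1 : ℝ) ≤ t * V i j + 1)
    linarith
  have hsum := hbad.atTop_add hgood
  have hlt : ∀ᶠ t in nhdsWithin (0 : ℝ) (Set.Ioi 0), t < 1 :=
    nhdsWithin_le_nhds (eventually_lt_nhds one_pos)
  obtain ⟨t, ht, ht₁, ht₀⟩ :=
    ((hsum.eventually_gt_atTop 0).and (hlt.and self_mem_nhdsWithin)).exists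
  have ht₀ : 0 < t := ht₀
  have hle := sum_deriv_segment_nonpos hZ hmax hV ht₀ ht₁
  rw [← Fintype.sum_prod_type' (f := fun i j => F (i, j) t)] at hle
  have hnotin : (i, j) ∉ G := by simp [hG, hij]
  -- The discarded entries have Z = 0, so they only add nonnegative terms.
  have hsub : ∑ x ∈ insert (i, j) G, F x t ≤ ∑ x, F x t := by
    refine Finset.sum_le_sum_of_subset_of_nonneg (Finset.subset_univ _) fun x _ hx => ?_
    have hx0 : Z x.1 x.2 = 0 := by
      rw [Finset.mem_insert, not_or] at hx
      have : ¬ 0 < Z x.1 x.2 := by simpa [hG] using hx.2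
      exact le_antisymm (not_lt.1 this) (hZ.1 _ _)
    simp only [hF, hx0, sub_zero, zero_add]
    refine mul_nonneg ?_ (hV.1 _ _)
    rcases (hV.1 x.1 x.2).eq_or_lt with h0 | hpos
    · rw [← h0]; simp
    · rw [sub_nonneg]
      exact Real.log_le_log (by positivity) (by linarith)
  rw [Finset.sum_insert hnotin] at hsub
  linarith

/-- The first order condition at the typical table. -/
lemma sum_deriv_maximizer_nonpos (hZ : Z ∈ polytope r c)
    (hmax : IsMaxOn tableEntropy (polytope r c) Z) {V : ι → κ → ℝ} (hV : V ∈ polytope r c) :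
    ∑ i, ∑ j, (Real.log (Z i j + 1) - Real.log (Z i j)) * (V i j - Z i j) ≤ 0 := by
  have hlim : Tendsto (fun t : ℝ => ∑ i, ∑ j, (Real.log (Z i j + t * (V i j - Z i j) + 1) -
      Real.log (Z i j + t * (V i j - Z i j))) * (V i j - Z i j)) (nhdsWithin 0 (Set.Ioi 0))
      (nhds (∑ i, ∑ j, (Real.log (Z i j + 1) - Real.log (Z i j)) * (V i j - Z i j))) := by
    refine tendsto_finsetSum _ fun i _ => tendsto_finsetSum _ fun j _ => tendsto_deriv_segment ?_
    rcases (hZ.1 i j).eq_or_lt with h0 | hpos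
    · exact Or.inr (by rw [← h0, eq_zero_of_maximizer_eq_zero hZ hmax hV h0.symm])
    · exact Or.inl hpos
  refine le_of_tendsto hlim ?_
  have hlt : ∀ᶠ t in nhdsWithin (0 : ℝ) (Set.Ioi 0), t < 1 :=
    nhdsWithin_le_nhds (eventually_lt_nhds one_pos)
  filter_upwards [hlt, self_mem_nhdsWithin] with t ht₁ ht₀
  exact sum_deriv_segment_nonpos hZ hmax hV ht₀ ht₁

instance isProbabilityMeasure_geomLaw (a : ℝ≥0) : IsProbabilityMeasure (geomLaw a) := by
  unfold geomLaw
  infer_instance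

instance isProbabilityMeasure_geomTableLaw (Z : ι → κ → ℝ) :
    IsProbabilityMeasure (geomTableLaw Z) := by
  unfold geomTableLaw
  infer_instance

lemma geomTableLaw_real_singleton (hZ : ∀ i j, 0 ≤ Z i j) (M : ι → κ → ℕ) :
    (geomTableLaw Z).real {M} =
      ∏ i, ∏ j, (1 / (1 + Z i j)) * (Z i j / (1 + Z i j)) ^ M i j := by
  rw [measureReal_def, geomTableLaw, Measure.pi_singleton, ENNReal.toReal_prod]
  refine Finset.prod_congr rfl fun i _ => ?_
  rw [Measure.pi_singleton, ENNReal.toReal_prod]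
  refine Finset.prod_congr rfl fun j _ => ?_
  rw [← measureReal_def, geomLaw_real_singleton, Real.coe_toNNReal _ (hZ i j)]

lemma natCast_mem_polytope {M : ι → κ → ℕ} (hM : M ∈ tables r c) :
    (fun i j => (M i j : ℝ)) ∈ polytope r c :=
  ⟨fun i j => Nat.cast_nonneg _, fun i => by rw [← hM.1 i]; push_cast; rfl,
    fun j => by rw [← hM.2 j]; push_cast; rfl⟩

/-- Every contingency table has probability at least `exp (-g(Z))` in the geometric model. -/
lemma exp_neg_tableEntropy_le (hZ : Z ∈ polytope r c)
    (hmax : IsMaxOn tableEntropy (polytope r c) Z) {M : ι → κ → ℕ} (hM : M ∈ tables r c) :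
    Real.exp (-tableEntropy Z) ≤ (geomTableLaw Z).real {M} := by
  have hV := natCast_mem_polytope hM
  -- The log mass of Geom(z) at M is minus the tangent of the entropy at z, evaluated at M. At z = 0
  -- this needs M = 0.
  have hentry : ∀ i j, (1 / (1 + Z i j)) * (Z i j / (1 + Z i j)) ^ M i j =
      Real.exp (-(entropyFun (Z i j) +
        (Real.log (Z i j + 1) - Real.log (Z i j)) * (M i j - Z i j))) := by
    intro i j
    rcases (hZ.1 i j).eq_or_lt with h0 | hpos
    · have := eq_zero_of_maximizer_eq_zero hZ hmax hV h0.symm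
      have h1 : M i j = 0 := by exact_mod_cast this
      rw [← h0, h1]
      simp [entropyFun_zero]
    · have h1 : 0 < 1 + Z i j := by linarith
      rw [← Real.exp_log (show 0 < (1 / (1 + Z i j)) * (Z i j / (1 + Z i j)) ^ M i j by positivity),
        Real.log_mul (by positivity) (by positivity), Real.log_pow,
        Real.log_div one_ne_zero h1.ne', Real.log_div hpos.ne' h1.ne', Real.log_one, entropyFun,
        add_comm 1 (Z i j)]
      congr 1
      ring
  rw [geomTableLaw_real_singleton hZ.1]
  simp only [hentry, ← Real.exp_sum]
  rw [Real.exp_le_exp]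
  simp only [Finset.sum_neg_distrib, Finset.sum_add_distrib]
  have := sum_deriv_maximizer_nonpos hZ hmax hV
  rw [neg_le_neg_iff, tableEntropy]
  linarith

/-- Transference: an event that is rare in the geometric model is rare for uniform tables. -/
lemma uniformTableLaw_real_le (hZ : Z ∈ polytope r c)
    (hmax : IsMaxOn tableEntropy (polytope r c) Z) (hne : (tables r c).Nonempty)
    (A : Set (ι → κ → ℕ)) :
    (uniformTableLaw r c).real A ≤
      Real.exp (tableEntropy Z - Real.log (tables r c).ncard) * (geomTableLaw Z).real A := by
  classical
  set T := (tables_finite r c).toFinset with hT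
  have hTc : (T : Set (ι → κ → ℕ)) = tables r c := Set.Finite.coe_toFinset _
  have hcard : (tables r c).ncard = T.card := Set.ncard_eq_toFinset_card _ _
  have hpos : (0 : ℝ) < T.card := by
    rw [← hcard]
    exact_mod_cast (Set.ncard_pos (tables_finite r c)).2 hne
  set U := T.filter (· ∈ A) with hU
  have h1 : (uniformTableLaw r c).real A = U.card / T.card := by
    rw [measureReal_def, uniformTableLaw, ← uniformOn_inter_self (tables_finite r c)]
    have e : tables r c ∩ A = (U : Set (ι → κ → ℕ)) := by
      rw [← hTc, hU, Finset.coe_filter]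
      rfl
    have e2 : T ∩ U = U := Finset.inter_eq_right.2 (Finset.filter_subset _ _)
    rw [e, ← hTc, uniformOn_apply_finset, e2, ENNReal.toReal_div]
    simp
  have h2 : U.card * Real.exp (-tableEntropy Z) ≤ (geomTableLaw Z).real A := by
    calc U.card * Real.exp (-tableEntropy Z) = ∑ _M ∈ U, Real.exp (-tableEntropy Z) := by
          rw [Finset.sum_const, nsmul_eq_mul]
      _ ≤ ∑ M ∈ U, (geomTableLaw Z).real {M} := by
          refine Finset.sum_le_sum fun M hM => exp_neg_tableEntropy_le hZ hmax ?_
          rw [← hTc]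
          exact Finset.mem_of_mem_filter M hM
      _ = (geomTableLaw Z).real U := sum_measureReal_singleton U
      _ ≤ (geomTableLaw Z).real A := by
          refine measureReal_mono fun M hM => ?_
          exact (Finset.mem_filter.1 hM).2
  rw [h1, hcard, Real.exp_sub, Real.exp_log hpos, div_mul_eq_mul_div]
  gcongr
  rw [Real.exp_neg, ← div_eq_mul_inv, div_le_iff₀ (Real.exp_pos _)] at h2
  linarith

end Transference

/-! ### Hoeffding's inequality over disjoint sets of entries -/

section Concentration

variable {Ω α γ ρ : Type*} [MeasurableSpace Ω] [Fintype ρ] {μ : Measure Ω} [IsProbabilityMeasure μ]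
  {f : α → Ω → ℕ}

open Classical in
/-- The centered indicator of the event that the entries at the positions `s` form a vector
in `A`. -/
noncomputable def centeredIndicator (f : α → Ω → ℕ) (A : Set (ρ → ℕ)) (a : ℝ) (s : ρ → α) (ω : Ω) :
    ℝ :=
  (if (fun l => f (s l) ω) ∈ A then 1 else 0) - a

lemma hasSubgaussianMGF_centeredIndicator (hf : ∀ x, Measurable (f x)) (A : Set (ρ → ℕ)) {a : ℝ}
    (s : ρ → α) (ha : μ.real {ω | (fun l => f (s l) ω) ∈ A} = a) :
    HasSubgaussianMGF (centeredIndicator f A a s) (1 / 4) μ := by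
  classical
  have hm : Measurable fun ω => fun l => f (s l) ω := measurable_pi_lambda _ fun l => hf _
  have hset : MeasurableSet {ω | (fun l => f (s l) ω) ∈ A} := hm (MeasurableSet.of_discrete (s := A))
  have hind : Measurable fun ω => if (fun l => f (s l) ω) ∈ A then (1 : ℝ) else 0 :=
    Measurable.ite hset measurable_const measurable_const
  have h := hasSubgaussianMGF_of_mem_Icc (μ := μ) (a := 0) (b := 1) hind.aemeasurable
    (Eventually.of_forall fun ω => by split_ifs <;> simp)
  have hint : ∫ ω, (if (fun l => f (s l) ω) ∈ A then (1 : ℝ) else 0) ∂μ = a := by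
    rw [← ha, ← integral_indicator_one hset]
    rfl
  rw [hint] at h
  have e : ((‖(1 : ℝ) - 0‖₊ / 2) ^ 2 : ℝ≥0) = 1 / 4 := by
    rw [sub_zero, nnnorm_one]
    norm_num
  rw [e] at h
  exact h

/-- Disjoint position sets carry independent indicators, so the variance proxies 1/4 add up.
Positions inside one copy may coincide, hence the passage to images `S` and `T`. -/
lemma hasSubgaussianMGF_sum_centeredIndicator (hindep : iIndepFun f μ)
    (hf : ∀ x, Measurable (f x)) (A : Set (ρ → ℕ)) {a : ℝ} (s : γ → ρ → α) (I : Finset γ)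
    (hdisj : ∀ g ∈ I, ∀ h ∈ I, g ≠ h → ∀ l l', s g l ≠ s h l')
    (ha : ∀ g ∈ I, μ.real {ω | (fun l => f (s g l) ω) ∈ A} = a) :
    HasSubgaussianMGF (fun ω => ∑ g ∈ I, centeredIndicator f A a (s g) ω) (I.card * (1 / 4)) μ := by
  classical
  induction I using Finset.induction_on with
  | empty => simp
  | insert g I hg ih =>
    have h1 := ih (fun x hx y hy => hdisj x (Finset.mem_insert_of_mem hx) y
      (Finset.mem_insert_of_mem hy)) fun x hx => ha x (Finset.mem_insert_of_mem hx)
    have h2 := hasSubgaussianMGF_centeredIndicator hf A (s g) (ha g (Finset.mem_insert_self _ _))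
    set S := Finset.univ.image (s g) with hS
    set T := I.biUnion fun h => Finset.univ.image (s h) with hT
    have hST : Disjoint S T := by
      rw [Finset.disjoint_left]
      intro x hx hx'
      simp only [hS, hT, Finset.mem_image, Finset.mem_univ, true_and, Finset.mem_biUnion] at hx hx'
      obtain ⟨l, rfl⟩ := hx
      obtain ⟨h, hh, l', hl'⟩ := hx'
      refine hdisj g (Finset.mem_insert_self _ _) h (Finset.mem_insert_of_mem hh) ?_ l l' hl'.symm
      rintro rfl
      exact hg hh
    have hi := hindep.indepFun_finset S T hST hf
    have hmS : ∀ l, s g l ∈ S := fun l => Finset.mem_image_of_mem _ (Finset.mem_univ l)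
    have hmT : ∀ h ∈ I, ∀ l, s h l ∈ T := fun h hh l =>
      Finset.mem_biUnion.2 ⟨h, hh, Finset.mem_image_of_mem _ (Finset.mem_univ l)⟩
    have hi' := hi.comp
      (φ := fun y : S → ℕ => (if (fun l => y ⟨s g l, hmS l⟩) ∈ A then (1 : ℝ) else 0) - a)
      (ψ := fun y : T → ℕ => ∑ h ∈ I.attach,
        ((if (fun l => y ⟨s h l, hmT h h.2 l⟩) ∈ A then (1 : ℝ) else 0) - a))
      (Measurable.of_discrete) (Measurable.of_discrete)
    have e2 : (fun y : T → ℕ => ∑ h ∈ I.attach,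
        ((if (fun l => y ⟨s h l, hmT h h.2 l⟩) ∈ A then (1 : ℝ) else 0) - a)) ∘
        (fun ω (x : T) => f x ω) = fun ω => ∑ h ∈ I, centeredIndicator f A a (s h) ω := by
      funext ω
      rw [← Finset.sum_attach I]
      rfl
    rw [e2] at hi'
    have h3 := h2.add_of_indepFun h1 hi'
    simp only [Finset.sum_insert hg, Finset.card_insert_of_notMem hg]
    convert h3 using 1
    push_cast
    ring

/-- Hoeffding's inequality for the empirical frequency of `A` over disjoint sets of entries. -/
lemma measureReal_frequency_deviation_le (hindep : iIndepFun f μ)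
    (hf : ∀ x, Measurable (f x)) (A : Set (ρ → ℕ)) {a : ℝ} (s : γ → ρ → α) (I : Finset γ)
    (hI : I.Nonempty)
    (hdisj : ∀ g ∈ I, ∀ h ∈ I, g ≠ h → ∀ l l', s g l ≠ s h l')
    (ha : ∀ g ∈ I, μ.real {ω | (fun l => f (s g l) ω) ∈ A} = a) {t : ℝ} (ht : 0 ≤ t) :
    μ.real {ω | I.card * t ≤ |∑ g ∈ I, centeredIndicator f A a (s g) ω|} ≤
      2 * Real.exp (-(2 * I.card * t ^ 2)) := by
  have h := hasSubgaussianMGF_sum_centeredIndicator hindep hf A s I hdisj ha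
  have hc : (0 : ℝ) < I.card := by exact_mod_cast hI.card_pos
  have hε : 0 ≤ (I.card : ℝ) * t := by positivity
  have h1 := h.measure_ge_le hε
  have h2 := h.neg.measure_ge_le hε
  have e : -((I.card : ℝ) * t) ^ 2 / (2 * ((I.card * (1 / 4) : ℝ≥0) : ℝ)) =
      -(2 * I.card * t ^ 2) := by
    push_cast
    field_simp
    ring
  rw [e] at h1 h2
  refine (measureReal_mono (fun ω hω => ?_)).trans ((measureReal_union_le _ _).trans
    ((add_le_add h1 h2).trans (by linarith)))
  rw [Set.mem_ofPred_eq] at hω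
  rcases le_abs.1 hω with h | h
  · exact Or.inl h
  · exact Or.inr h

end Concentration

/-! ### Invariance under block permutations and comparison of the two laws -/

section Exchangeability

variable {ι κ : Type*} [Fintype ι] [Fintype κ]

/-- Permuting the rows and the columns of a table. -/
def permuteTable {R : Type*} (σ : Equiv.Perm ι) (τ : Equiv.Perm κ) :
    (ι → κ → R) ≃ (ι → κ → R) where
  toFun M i j := M (σ i) (τ j)
  invFun M i j := M (σ.symm i) (τ.symm j)
  left_inv M := by simp
  right_inv M := by simp

variable {r : ι → ℕ} {c : κ → ℕ} {Z : ι → κ → ℝ} {σ : Equiv.Perm ι} {τ : Equiv.Perm κ}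

lemma permuteTable_mem_tables (hr : ∀ i, r (σ i) = r i) (hc : ∀ j, c (τ j) = c j)
    (M : ι → κ → ℕ) : permuteTable σ τ M ∈ tables r c ↔ M ∈ tables r c := by
  have h1 : (∀ i, ∑ j, M (σ i) (τ j) = r i) ↔ ∀ i, ∑ j, M i j = r i := by
    refine Iff.trans ?_ (σ.surjective.forall (p := fun i => ∑ j, M i j = r i)).symm
    refine forall_congr' fun i => ?_
    rw [hr, Equiv.sum_comp τ fun j => M (σ i) j]
  have h2 : (∀ j, ∑ i, M (σ i) (τ j) = c j) ↔ ∀ j, ∑ i, M i j = c j := by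
    refine Iff.trans ?_ (τ.surjective.forall (p := fun j => ∑ i, M i j = c j)).symm
    refine forall_congr' fun j => ?_
    rw [hc, Equiv.sum_comp σ fun i => M i (τ j)]
  exact and_congr h1 h2

lemma permuteTable_mem_polytope (hr : ∀ i, r (σ i) = r i) (hc : ∀ j, c (τ j) = c j)
    (hZ : Z ∈ polytope r c) : permuteTable σ τ Z ∈ polytope r c := by
  refine ⟨fun i j => hZ.1 _ _, fun i => ?_, fun j => ?_⟩
  · rw [← hr, ← hZ.2.1 (σ i)]
    exact Equiv.sum_comp τ fun j => Z (σ i) j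
  · rw [← hc, ← hZ.2.2 (τ j)]
    exact Equiv.sum_comp σ fun i => Z i (τ j)

/-- The permuted table is again a maximizer, and the maximizer is unique. -/
lemma permuteTable_maximizer (hr : ∀ i, r (σ i) = r i) (hc : ∀ j, c (τ j) = c j)
    (hZ : Z ∈ polytope r c) (hmax : IsMaxOn tableEntropy (polytope r c) Z) :
    permuteTable σ τ Z = Z := by
  have h : tableEntropy (permuteTable σ τ Z) = tableEntropy Z := by
    unfold tableEntropy
    rw [← Equiv.sum_comp σ fun i => ∑ j, entropyFun (Z i j)]
    refine Finset.sum_congr rfl fun i _ => ?_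
    rw [← Equiv.sum_comp τ fun j => entropyFun (Z (σ i) j)]
    rfl
  refine (strictConcaveOn_tableEntropy r c).eq_of_isMaxOn (fun W hW => ?_) hmax
    (permuteTable_mem_polytope hr hc hZ) hZ
  show tableEntropy W ≤ tableEntropy (permuteTable σ τ Z)
  rw [h]
  exact hmax hW

lemma uniformTableLaw_real_preimage_permuteTable (hr : ∀ i, r (σ i) = r i)
    (hc : ∀ j, c (τ j) = c j) (A : Set (ι → κ → ℕ)) :
    (uniformTableLaw r c).real (permuteTable σ τ ⁻¹' A) = (uniformTableLaw r c).real A := by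
  have hm : MeasurableSet (tables r c) := .of_discrete
  rw [measureReal_def, measureReal_def, uniformTableLaw, uniformOn, cond_apply hm, cond_apply hm]
  have e : tables r c ∩ permuteTable σ τ ⁻¹' A = (permuteTable σ τ).symm '' (tables r c ∩ A) := by
    rw [Equiv.image_symm_eq_preimage]
    ext M
    simp only [Set.mem_inter_iff, Set.mem_preimage, permuteTable_mem_tables hr hc]
  rw [e, Measure.count_injective_image (permuteTable σ τ).symm.injective]

lemma geomTableLaw_real_preimage_permuteTable (hZ : permuteTable σ τ Z = Z)
    (A : Set (ι → κ → ℕ)) :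
    (geomTableLaw Z).real (permuteTable σ τ ⁻¹' A) = (geomTableLaw Z).real A := by
  have hm : Measurable (permuteTable σ τ : (ι → κ → ℕ) → ι → κ → ℕ) := .of_discrete
  have hmap : (geomTableLaw Z).map (permuteTable σ τ) = geomTableLaw Z := by
    refine Measure.ext_of_singleton fun M => ?_
    have e : permuteTable σ τ ⁻¹' {M} = {(permuteTable σ τ).symm M} := by
      rw [← Equiv.image_symm_eq_preimage, Set.image_singleton]
    rw [Measure.map_apply hm (measurableSet_singleton M), e, geomTableLaw, Measure.pi_singleton,
      Measure.pi_singleton, ← Equiv.prod_comp σ]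
    refine Finset.prod_congr rfl fun i _ => ?_
    rw [Measure.pi_singleton, Measure.pi_singleton, ← Equiv.prod_comp τ]
    refine Finset.prod_congr rfl fun j _ => ?_
    have h1 : Z (σ i) (τ j) = Z i j := congrFun (congrFun hZ i) j
    have h2 : (permuteTable σ τ).symm M (σ i) (τ j) = M i j := by simp [permuteTable]
    rw [h1, h2]
  rw [measureReal_def, measureReal_def, ← Measure.map_apply hm .of_discrete, hmap]

lemma iIndepFun_entries (Z : ι → κ → ℝ) :
    iIndepFun (fun (x : ι × κ) (M : ι → κ → ℕ) => M x.1 x.2) (geomTableLaw Z) := by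
  have := iIndepFun_uncurry_infinitePi' (X := fun (_ : ι) (_ : κ) (n : ℕ) => n)
    (fun i j => geomLaw (Z i j).toNNReal) fun _ _ => measurable_id
  rw [Measure.infinitePi_eq_pi] at this
  simpa only [Measure.infinitePi_eq_pi, geomTableLaw] using this

/-- Comparison of the uniform and the geometric model on an event that depends on few entries,
when there are many disjoint copies of the positions of these entries. -/
lemma abs_uniformTableLaw_sub_geomTableLaw_le {γ ρ : Type*} [Fintype ρ] (hZ : Z ∈ polytope r c)
    (hmax : IsMaxOn tableEntropy (polytope r c) Z) (hne : (tables r c).Nonempty)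
    (σ : γ → Equiv.Perm ι) (τ : γ → Equiv.Perm κ) (hr : ∀ g i, r (σ g i) = r i)
    (hc : ∀ g j, c (τ g j) = c j) (i : ρ → ι) (j : ρ → κ) (I : Finset γ) (hI : I.Nonempty)
    (hdisj : ∀ g ∈ I, ∀ h ∈ I, g ≠ h → ∀ l l', (σ g (i l), τ g (j l)) ≠ (σ h (i l'), τ h (j l')))
    (A : Set (ρ → ℕ)) {t : ℝ} (ht : 0 ≤ t) :
    |(uniformTableLaw r c).real {M | (fun l => M (i l) (j l)) ∈ A} -
      (geomTableLaw Z).real {M | (fun l => M (i l) (j l)) ∈ A}| ≤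
    t + 2 * Real.exp (tableEntropy Z - Real.log (tables r c).ncard - 2 * I.card * t ^ 2) := by
  classical
  set μ := uniformTableLaw r c with hμ
  set ν := geomTableLaw Z with hν
  set q := μ.real {M | (fun l => M (i l) (j l)) ∈ A} with hq
  set a := ν.real {M | (fun l => M (i l) (j l)) ∈ A} with ha
  have hμp : IsProbabilityMeasure μ := isProbabilityMeasure_uniformOn (tables_finite r c) hne
  set f : ι × κ → (ι → κ → ℕ) → ℕ := fun x M => M x.1 x.2 with hf
  set s : γ → ρ → ι × κ := fun g l => (σ g (i l), τ g (j l)) with hs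
  have hpre : ∀ g, {M : ι → κ → ℕ | (fun l => f (s g l) M) ∈ A} =
      permuteTable (σ g) (τ g) ⁻¹' {M | (fun l => M (i l) (j l)) ∈ A} := fun g => rfl
  have hqg : ∀ g, μ.real {M | (fun l => f (s g l) M) ∈ A} = q := fun g => by
    rw [hpre, hμ, uniformTableLaw_real_preimage_permuteTable (hr g) (hc g)]
  have hag : ∀ g, ν.real {M | (fun l => f (s g l) M) ∈ A} = a := fun g => by
    rw [hpre, hν, geomTableLaw_real_preimage_permuteTable
      (permuteTable_maximizer (hr g) (hc g) hZ hmax)]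
  have hN : (0 : ℝ) < I.card := by exact_mod_cast hI.card_pos
  set D : (ι → κ → ℕ) → ℝ := fun M => ∑ g ∈ I, centeredIndicator f A a (s g) M with hD
  set E : Set (ι → κ → ℕ) := {M | I.card * t ≤ |D M|} with hE
  have ha0 : 0 ≤ a := measureReal_nonneg
  have ha1 : a ≤ 1 := measureReal_le_one
  have hcent : ∀ g M, |centeredIndicator f A a (s g) M| ≤ 1 := by
    intro g M
    unfold centeredIndicator
    rw [abs_le]
    split_ifs <;> constructor <;> linarith
  have hDle : ∀ M, |D M| ≤ I.card := by
    intro M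
    refine (Finset.abs_sum_le_sum_abs _ _).trans ((Finset.sum_le_sum fun g _ => hcent g M).trans ?_)
    simp
  have hcint : ∀ g, Integrable (centeredIndicator f A a (s g)) μ := fun g =>
    Integrable.of_bound (Measurable.of_discrete.aestronglyMeasurable) 1
      (Eventually.of_forall (hcent g))
  have hmean : ∀ g, ∫ M, centeredIndicator f A a (s g) M ∂μ = q - a := by
    intro g
    have h1 : ∫ M, (if (fun l => f (s g l) M) ∈ A then (1 : ℝ) else 0) ∂μ = q := by
      rw [← hqg g, ← integral_indicator_one (MeasurableSet.of_discrete)]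
      rfl
    have h2 : Integrable (fun M => if (fun l => f (s g l) M) ∈ A then (1 : ℝ) else 0) μ :=
      Integrable.of_bound (Measurable.of_discrete.aestronglyMeasurable) 1
        (Eventually.of_forall fun M => by split_ifs <;> simp)
    unfold centeredIndicator
    rw [← h1]
    rw [integral_sub (by convert h2) (integrable_const a), integral_const]
    simp
  have hDmean : ∫ M, D M ∂μ = I.card * (q - a) := by
    rw [hD, integral_finsetSum _ fun g _ => hcint g,
      Finset.sum_congr rfl fun g _ => hmean g, Finset.sum_const, nsmul_eq_mul]
  -- Off the deviation event |D| is less than N t, and on it at most N, with N = `I.card`. As D has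
  -- uniform mean N (q - a), integrating gives |q - a| ≤ t + μ(E), and μ(E) is bounded by
  -- transference.
  have hbound : ∀ M, |D M| ≤ I.card * t + I.card * E.indicator 1 M := by
    intro M
    by_cases hM : M ∈ E
    · rw [Set.indicator_of_mem hM]
      have := hDle M
      have : 0 ≤ (I.card : ℝ) * t := by positivity
      simp only [Pi.one_apply]
      linarith
    · rw [Set.indicator_of_notMem hM]
      have : |D M| < I.card * t := not_le.1 hM
      linarith
  have hDint : Integrable (fun M => |D M|) μ :=
    (integrable_finsetSum _ fun g _ => hcint g).abs
  have hEint : Integrable (E.indicator (1 : (ι → κ → ℕ) → ℝ)) μ :=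
    (integrable_const (1 : ℝ)).indicator .of_discrete
  have h1 : |(I.card : ℝ) * (q - a)| ≤ I.card * t + I.card * μ.real E := by
    rw [← hDmean]
    refine abs_integral_le_integral_abs.trans ?_
    have h2 := integral_mono (μ := μ) hDint
      ((integrable_const ((I.card : ℝ) * t)).add (hEint.const_mul (I.card : ℝ))) hbound
    have h3 : ∫ M, ((I.card : ℝ) * t + I.card * E.indicator (1 : (ι → κ → ℕ) → ℝ) M) ∂μ =
        I.card * t + I.card * μ.real E := by
      rw [integral_add (integrable_const _) (hEint.const_mul _), integral_const,
        integral_const_mul, integral_indicator_one (MeasurableSet.of_discrete)]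
      simp
    exact h2.trans h3.le
  have h2 : |q - a| ≤ t + μ.real E := by
    rw [abs_mul, abs_of_pos hN, ← mul_add] at h1
    exact le_of_mul_le_mul_left h1 hN
  have h3 := uniformTableLaw_real_le hZ hmax hne E
  have h4 : ν.real E ≤ 2 * Real.exp (-(2 * I.card * t ^ 2)) :=
    measureReal_frequency_deviation_le (iIndepFun_entries Z) (fun x => Measurable.of_discrete) A s I
      hI hdisj (fun g _ => hag g) ht
  have h5 := mul_le_mul_of_nonneg_left h4
    (Real.exp_pos (tableEntropy Z - Real.log (tables r c).ncard)).le
  rw [mul_left_comm, ← Real.exp_add, ← sub_eq_add_neg] at h5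
  linarith

end Exchangeability

/-! ### Total variation from differences on events -/

section TotalVariation

/-- The points where μ - ν is nonnegative and those where it is negative contribute at most b each.
-/
lemma tvDist_le_two_mul {α : Type*} [MeasurableSpace α] [MeasurableSingletonClass α]
    (μ ν : Measure α) [IsFiniteMeasure μ] [IsFiniteMeasure ν] {b : ℝ}
    (h : ∀ A : Finset α, |μ.real A - ν.real A| ≤ b) : tvDist μ ν ≤ 2 * b := by
  classical
  refine Real.tsum_le_of_sum_le (fun _ => abs_nonneg _) fun F => ?_
  rw [← Finset.sum_filter_add_sum_filter_not F fun x => 0 ≤ μ.real {x} - ν.real {x}]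
  have h1 : ∑ x ∈ F with 0 ≤ μ.real {x} - ν.real {x}, |μ.real {x} - ν.real {x}| ≤ b := by
    refine le_trans (le_of_eq ?_) ((le_abs_self _).trans
      (h (F.filter fun x => 0 ≤ μ.real {x} - ν.real {x})))
    rw [← sum_measureReal_singleton, ← sum_measureReal_singleton, ← Finset.sum_sub_distrib]
    exact Finset.sum_congr rfl fun x hx => abs_of_nonneg (Finset.mem_filter.1 hx).2
  have h2 : ∑ x ∈ F with ¬ 0 ≤ μ.real {x} - ν.real {x}, |μ.real {x} - ν.real {x}| ≤ b := by
    refine le_trans (le_of_eq ?_) ((neg_le_abs _).trans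
      (h (F.filter fun x => ¬ 0 ≤ μ.real {x} - ν.real {x})))
    rw [← sum_measureReal_singleton, ← sum_measureReal_singleton, ← Finset.sum_sub_distrib,
      ← Finset.sum_neg_distrib]
    exact Finset.sum_congr rfl fun x hx => abs_of_neg (not_le.1 (Finset.mem_filter.1 hx).2)
  linarith

lemma tvDist_map_le {Ω β : Type*} [MeasurableSpace Ω] [DiscreteMeasurableSpace Ω]
    [MeasurableSpace β] [MeasurableSingletonClass β] (μ ν : Measure Ω) [IsFiniteMeasure μ]
    [IsFiniteMeasure ν] (F : Ω → β) {b : ℝ}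
    (h : ∀ A : Set β, |μ.real (F ⁻¹' A) - ν.real (F ⁻¹' A)| ≤ b) :
    tvDist (μ.map F) (ν.map F) ≤ 2 * b := by
  have hF : Measurable F := .of_discrete
  refine tvDist_le_two_mul _ _ fun A => ?_
  rw [map_measureReal_apply hF A.measurableSet, map_measureReal_apply hF A.measurableSet]
  exact h A

end TotalVariation

/-! ### Disjoint copies of positions and cyclic block shifts -/

section DisjointCopies

/-- In a maximal disjoint subfamily I every g meets some h in I at a pair of indices (l, l'). By
injectivity each triple (h, l, l') accounts for at most one g. -/
lemma exists_disjoint_subfamily {γ ρ α : Type*} [Fintype γ] [Fintype ρ] [Nonempty ρ]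
    (s : γ → ρ → α) (hs : ∀ l, Function.Injective fun g => s g l) :
    ∃ I : Finset γ, (∀ g ∈ I, ∀ h ∈ I, g ≠ h → ∀ l l', s g l ≠ s h l') ∧
      Fintype.card γ ≤ I.card * Fintype.card ρ ^ 2 := by
  classical
  let P : Finset (Finset γ) :=
    {I | ∀ g ∈ I, ∀ h ∈ I, g ≠ h → ∀ l l', s g l ≠ s h l'}
  obtain ⟨I, hI, hImax⟩ := P.exists_max_image Finset.card ⟨∅, by simp [P]⟩
  have hI : ∀ g ∈ I, ∀ h ∈ I, g ≠ h → ∀ l l', s g l ≠ s h l' := by simpa [P] using hI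
  refine ⟨I, hI, ?_⟩
  have hcover : ∀ g, ∃ h ∈ I, ∃ l l', s g l = s h l' := by
    intro g
    by_contra! hcon
    by_cases hg : g ∈ I
    · exact hcon g hg (Classical.arbitrary ρ) (Classical.arbitrary ρ) rfl
    · have hmem : insert g I ∈ P := by
        simp only [P, Finset.mem_filter, Finset.mem_univ, true_and]
        intro x hx y hy hxy l l'
        rcases Finset.mem_insert.1 hx with rfl | hxI <;> rcases Finset.mem_insert.1 hy with rfl | hyI
        · exact absurd rfl hxy
        · exact hcon y hyI l l'
        · exact (hcon x hxI l' l).symm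
        · exact hI x hxI y hyI hxy l l'
      have := hImax _ hmem
      rw [Finset.card_insert_of_notMem hg] at this
      omega
  have hsub : (Finset.univ : Finset γ) ⊆ (I ×ˢ (Finset.univ : Finset (ρ × ρ))).biUnion
      fun x => {g | s g x.2.1 = s x.1 x.2.2} := by
    intro g _
    obtain ⟨h, hh, l, l', e⟩ := hcover g
    exact Finset.mem_biUnion.2 ⟨(h, l, l'), by simp [hh], by simpa using e⟩
  have h1 := (Finset.card_le_card hsub).trans (Finset.card_biUnion_le_card_mul _ _ 1 fun x _ => ?_)
  · rw [Finset.card_univ, Finset.card_product, Finset.card_univ, Fintype.card_prod, mul_one,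
      ← sq] at h1
    exact h1
  · refine Finset.card_le_one.2 fun g hg h hh => hs x.2.1 ?_
    simp only [Finset.mem_filter, Finset.mem_univ, true_and] at hg hh
    exact hg.trans hh.symm

/-- Cyclic shift by `a` of the first `m` indices and by `b` of the last `n` indices. -/
def blockShift {m n : ℕ} [NeZero m] [NeZero n] (a : Fin m) (b : Fin n) :
    Equiv.Perm (Fin (m + n)) :=
  finSumFinEquiv.permCongr (Equiv.sumCongr (Equiv.addRight a) (Equiv.addRight b))

variable {m n : ℕ} [NeZero m] [NeZero n]

lemma blockShift_castAdd (a : Fin m) (b : Fin n) (x : Fin m) :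
    blockShift a b (Fin.castAdd n x) = Fin.castAdd n (x + a) := by
  simp [blockShift, Equiv.permCongr_apply]

lemma blockShift_natAdd (a : Fin m) (b : Fin n) (x : Fin n) :
    blockShift a b (Fin.natAdd m x) = Fin.natAdd m (x + b) := by
  simp [blockShift, Equiv.permCongr_apply]

lemma blockShift_lt_iff (a : Fin m) (b : Fin n) (x : Fin (m + n)) :
    (blockShift a b x : ℕ) < m ↔ (x : ℕ) < m := by
  refine Fin.addCases (fun x => ?_) (fun x => ?_) x
  · simp [blockShift_castAdd]
  · simp [blockShift_natAdd]

lemma eq_of_blockShift_eq_of_lt {a a' : Fin m} {b b' : Fin n} {x : Fin (m + n)} (hx : (x : ℕ) < m)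
    (h : blockShift a b x = blockShift a' b' x) : a = a' := by
  obtain ⟨y, rfl⟩ : ∃ y, x = Fin.castAdd n y := ⟨⟨x, hx⟩, rfl⟩
  rw [blockShift_castAdd, blockShift_castAdd] at h
  exact add_left_cancel (Fin.castAdd_injective m n h)

lemma eq_of_blockShift_eq_of_le {a a' : Fin m} {b b' : Fin n} {x : Fin (m + n)} (hx : m ≤ (x : ℕ))
    (h : blockShift a b x = blockShift a' b' x) : b = b' := by
  obtain ⟨y, rfl⟩ : ∃ y, x = Fin.natAdd m y :=
    ⟨⟨x - m, by omega⟩, by ext; simp; omega⟩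
  rw [blockShift_natAdd, blockShift_natAdd] at h
  exact add_left_cancel (Fin.natAdd_injective n m h)

end DisjointCopies

/-! ### The number of shifted copies in the three cases of η -/

section Shifts

lemma bezel_pos {n : ℕ} (hn : 1 ≤ n) {δ : ℝ} (hδ₀ : 0 ≤ δ) : 1 ≤ bezel n δ :=
  Nat.le_floor (by simpa using Real.one_le_rpow (by exact_mod_cast hn) hδ₀)

lemma bezel_le {n : ℕ} (hn : 1 ≤ n) {δ : ℝ} (hδ₁ : δ ≤ 1) : bezel n δ ≤ n := by
  refine Nat.floor_le_of_le ?_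
  have := Real.rpow_le_rpow_of_exponent_le (x := n) (by exact_mod_cast hn) hδ₁
  rwa [Real.rpow_one] at this

lemma rpow_le_two_mul_bezel {n : ℕ} (hn : 1 ≤ n) {δ : ℝ} (hδ₀ : 0 ≤ δ) :
    (n : ℝ) ^ δ ≤ 2 * bezel n δ := by
  have h1 : (n : ℝ) ^ δ < bezel n δ + 1 := Nat.lt_floor_add_one _
  have h2 : (1 : ℝ) ≤ bezel n δ := by exact_mod_cast bezel_pos hn hδ₀
  linarith

lemma eta_le_half {n k : ℕ} {δ : ℝ} (hδ₁ : δ ≤ 1) (i j : Fin k → Fin (bezel n δ + n)) :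
    eta n δ i j ≤ 1 / 2 := by
  unfold eta
  split_ifs <;> linarith

/-- Shifting rows and columns within the blocks moves given positions to about `n ^ (1 + 2 η)`
different places. -/
lemma exists_shifts {n k : ℕ} (hn : 1 ≤ n) {δ : ℝ} (hδ₀ : 0 ≤ δ) (hδ₁ : δ ≤ 1)
    (i j : Fin k → Fin (bezel n δ + n)) :
    ∃ (γ : Type) (_ : Fintype γ) (σ τ : γ → Equiv.Perm (Fin (bezel n δ + n))),
      (∀ g x, (σ g x : ℕ) < bezel n δ ↔ (x : ℕ) < bezel n δ) ∧
      (∀ g x, (τ g x : ℕ) < bezel n δ ↔ (x : ℕ) < bezel n δ) ∧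
      (∀ l, Function.Injective fun g => (σ g (i l), τ g (j l))) ∧
      (n : ℝ) ^ (1 + 2 * eta n δ i j) ≤ 4 * Fintype.card γ := by
  have hm := bezel_pos hn hδ₀
  have hmn := bezel_le hn hδ₁
  have hb := rpow_le_two_mul_bezel hn hδ₀
  have hn0 : (0 : ℝ) < n := by exact_mod_cast hn
  have hδn : 0 ≤ (n : ℝ) ^ δ := by positivity
  have : NeZero (bezel n δ) := ⟨by omega⟩
  have : NeZero n := ⟨by omega⟩
  by_cases h1 : ∀ l, bezel n δ ≤ (i l : ℕ) ∧ bezel n δ ≤ (j l : ℕ)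
  · refine ⟨Fin n × Fin n, inferInstance, fun g => blockShift 0 g.1, fun g => blockShift 0 g.2,
      fun g => blockShift_lt_iff _ _, fun g => blockShift_lt_iff _ _, fun l g h hgh => ?_, ?_⟩
    · simp only [Prod.mk.injEq] at hgh
      exact Prod.ext (eq_of_blockShift_eq_of_le (h1 l).1 hgh.1)
        (eq_of_blockShift_eq_of_le (h1 l).2 hgh.2)
    · rw [eta, if_pos h1, Fintype.card_prod, Fintype.card_fin, Nat.cast_mul]
      norm_num
      nlinarith [sq_nonneg (n : ℝ)]
  by_cases h2 : ∃ l, (i l : ℕ) < bezel n δ ∧ (j l : ℕ) < bezel n δ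
  · have hinj : ∀ (x x' : Fin (bezel n δ)) (y : Fin (bezel n δ + n)),
        blockShift x (Fin.castLE hmn x) y = blockShift x' (Fin.castLE hmn x') y → x = x' := by
      intro x x' y h
      rcases lt_or_ge (y : ℕ) (bezel n δ) with hy | hy
      · exact eq_of_blockShift_eq_of_lt hy h
      · exact Fin.castLE_injective hmn (eq_of_blockShift_eq_of_le hy h)
    refine ⟨Fin (bezel n δ) × Fin (bezel n δ), inferInstance, fun g => blockShift g.1 (Fin.castLE hmn g.1),
      fun g => blockShift g.2 (Fin.castLE hmn g.2), fun g => blockShift_lt_iff _ _,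
      fun g => blockShift_lt_iff _ _, fun l g h hgh => ?_, ?_⟩
    · simp only [Prod.mk.injEq] at hgh
      exact Prod.ext (hinj _ _ _ hgh.1) (hinj _ _ _ hgh.2)
    · rw [eta, if_neg h1, if_pos h2, Fintype.card_prod, Fintype.card_fin, Nat.cast_mul,
        show 1 + 2 * (δ - 1 / 2) = δ + δ by ring, Real.rpow_add hn0]
      nlinarith
  · refine ⟨Fin (bezel n δ) × Fin n, inferInstance, fun g => blockShift g.1 (g.2 + Fin.castLE hmn g.1),
      fun g => blockShift g.1 g.2, fun g => blockShift_lt_iff _ _,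
      fun g => blockShift_lt_iff _ _, fun l g h hgh => ?_, ?_⟩
    · simp only [Prod.mk.injEq] at hgh
      push Not at h2
      rcases lt_or_ge (i l : ℕ) (bezel n δ) with hi | hi
      · exact Prod.ext (eq_of_blockShift_eq_of_lt hi hgh.1)
          (eq_of_blockShift_eq_of_le (h2 l hi) hgh.2)
      · have e1 := eq_of_blockShift_eq_of_le hi hgh.1
        rcases lt_or_ge (j l : ℕ) (bezel n δ) with hj | hj
        · have e2 := eq_of_blockShift_eq_of_lt hj hgh.2
          rw [e2] at e1
          exact Prod.ext e2 (add_right_cancel e1)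
        · have e2 := eq_of_blockShift_eq_of_le hj hgh.2
          rw [e2] at e1
          exact Prod.ext (Fin.castLE_injective hmn (add_left_cancel e1)) e2
    · rw [eta, if_neg h1, if_neg h2, Fintype.card_prod, Fintype.card_fin, Fintype.card_fin,
        Nat.cast_mul, show 1 + 2 * (δ / 2) = δ + 1 by ring, Real.rpow_add hn0, Real.rpow_one]
      nlinarith

end Shifts

/-! ### Asymptotic estimates and conclusion -/

section Asymptotics

lemma margin_congr {n : ℕ} {δ B C : ℝ} {x y : Fin (bezel n δ + n)}
    (h : (x : ℕ) < bezel n δ ↔ (y : ℕ) < bezel n δ) : margin n δ B C x = margin n δ B C y := by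
  simp only [margin, h]

lemma sum_margin_le {n : ℕ} (hn : 1 ≤ n) {δ B C : ℝ} (hδ₁ : δ ≤ 1) (hB : 0 ≤ B) (hC : 0 ≤ C) :
    ((∑ x, margin n δ B C x : ℕ) : ℝ) ≤ 2 * (B * C + C) * n ^ 2 := by
  have h1 : ∀ x, (margin n δ B C x : ℝ) ≤ (B * C + C) * n := by
    intro x
    have hBC : 0 ≤ B * C * n := by positivity
    have hCn : 0 ≤ C * n := by positivity
    unfold margin
    split_ifs
    · exact (Nat.floor_le hBC).trans (by linarith)
    · exact (Nat.floor_le hCn).trans (by linarith)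
  push_cast
  refine (Finset.sum_le_sum fun x _ => h1 x).trans ?_
  rw [Finset.sum_const, Finset.card_univ, Fintype.card_fin, nsmul_eq_mul]
  have h2 : ((bezel n δ + n : ℕ) : ℝ) ≤ 2 * n := by
    exact_mod_cast (by have := bezel_le hn hδ₁; omega : bezel n δ + n ≤ 2 * n)
  calc ((bezel n δ + n : ℕ) : ℝ) * ((B * C + C) * n) ≤ 2 * n * ((B * C + C) * n) := by gcongr
    _ = _ := by ring

/-- The entropy of the typical table is the logarithm of the number of tables up to
`O(n log n)`. -/
lemma tableEntropy_typicalTable_le {n : ℕ} (hn : 1 ≤ n) {δ B C : ℝ} (hδ₀ : 0 ≤ δ) (hδ₁ : δ ≤ 1)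
    (hB : 0 ≤ B) (hC : 0 ≤ C) :
    tableEntropy (typicalTable (margin n δ B C) (margin n δ B C)
        (polytope_margin_nonempty n δ B C)) -
      Real.log (tables (margin n δ B C) (margin n δ B C)).ncard ≤
    n * (20 * Real.log ((2 * (B * C + C) + 5) * n ^ 2) + 12) := by
  have hm := bezel_pos hn hδ₀
  have hmn := bezel_le hn hδ₁
  have hn1 : (1 : ℝ) ≤ n := by exact_mod_cast hn
  have h := tableEntropy_le_of_two_blocks (fun x : Fin (bezel n δ + n) => decide ((x : ℕ) < bezel n δ))
    (by
      rintro (_ | _)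
      · exact ⟨Fin.natAdd _ ⟨0, by omega⟩, by simp⟩
      · exact ⟨Fin.castAdd _ ⟨0, by omega⟩, by simp; omega⟩)
    (margin n δ B C) (fun x y hxy => margin_congr (by simpa using hxy)) _
    (typicalTable_spec _ _ (polytope_margin_nonempty n δ B C)).1
  rw [Fintype.card_fin] at h
  have hN := sum_margin_le hn (δ := δ) hδ₁ hB hC
  set N := ∑ x, margin n δ B C x with hNdef
  -- The 5 absorbs (m+n)² ≤ 4n² and 1 ≤ n². The factor 20 in the claim is 4 from the margins plus 16
  -- from the four blocks.
  set L := Real.log ((2 * (B * C + C) + 5) * n ^ 2) with hL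
  have hsq : (1 : ℝ) ≤ n ^ 2 := one_le_pow₀ hn1
  have hBC : 0 ≤ B * C + C := by positivity
  have hcard : ((bezel n δ + n : ℕ) : ℝ) ≤ 2 * n := by
    exact_mod_cast (by omega : bezel n δ + n ≤ 2 * n)
  have hL1 : Real.log ((N + 1 : ℕ) : ℝ) ≤ L := by
    refine Real.log_le_log (by positivity) ?_
    push_cast
    nlinarith
  have hL2 : Real.log (((bezel n δ + n) * (bezel n δ + n) + N + 1 : ℕ) : ℝ) ≤ L := by
    refine Real.log_le_log (by positivity) ?_
    have h2 : ((bezel n δ + n : ℕ) : ℝ) * ((bezel n δ + n : ℕ) : ℝ) ≤ (2 * n) * (2 * n) := by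
      gcongr
    push_cast at h2 ⊢
    nlinarith
  have hL0 : 0 ≤ L := le_trans (Real.log_natCast_nonneg _) hL1
  have h3 : ((bezel n δ + n + (bezel n δ + n) : ℕ) : ℝ) * Real.log ((N + 1 : ℕ) : ℝ) ≤
      4 * n * L := by
    have : ((bezel n δ + n + (bezel n δ + n) : ℕ) : ℝ) ≤ 4 * n := by push_cast at hcard ⊢; linarith
    exact mul_le_mul this hL1 (Real.log_natCast_nonneg _) (by positivity)
  have h4 : L ≤ n * L := le_mul_of_one_le_left hL0 hn1
  linarith

lemma eventually_log_le_rpow {a b ε : ℝ} (ha : 0 < a) (hb : 0 < b) (hε : 0 < ε) :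
    ∀ᶠ n : ℕ in atTop, 20 * Real.log (a * n ^ 2) + 13 ≤ b * (n : ℝ) ^ ε := by
  have h1 : Tendsto (fun x : ℝ => Real.log x / x ^ ε) atTop (nhds 0) :=
    (isLittleO_log_rpow_atTop hε).tendsto_div_nhds_zero
  have h2 : Tendsto (fun x : ℝ => x ^ ε) atTop atTop := tendsto_rpow_atTop hε
  have h3 : ∀ᶠ x : ℝ in atTop, 20 * Real.log (a * x ^ 2) + 13 ≤ b * x ^ ε := by
    filter_upwards [h1.eventually_lt_const (show 0 < b / 80 by positivity),
      h2.eventually_ge_atTop ((20 * Real.log a + 13) / (b / 2)), eventually_gt_atTop 0]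
      with x hx1 hx2 hx0
    rw [div_lt_iff₀ (by positivity)] at hx1
    rw [div_le_iff₀ (by positivity)] at hx2
    rw [Real.log_mul ha.ne' (by positivity), Real.log_pow]
    push_cast
    linarith
  exact tendsto_natCast_atTop_atTop.eventually h3

lemma eventually_abs_lawX_sub_lawY_le (δ B C : ℝ) (hδ₀ : 0 ≤ δ) (hδ₁ : δ ≤ 1)
    (hB : 0 ≤ B) (hC : 0 ≤ C) (k : ℕ) (hk : 1 ≤ k) (ε : ℝ) (hε : 0 < ε) :
    ∀ᶠ n : ℕ in atTop, ∀ i j : Fin k → Fin (bezel n δ + n), ∀ A : Set (Fin k → ℕ),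
      2 * |(lawX n δ B C).real {M | (fun l => M (i l) (j l)) ∈ A} -
        (lawY n δ B C).real {M | (fun l => M (i l) (j l)) ∈ A}| ≤
      (n : ℝ) ^ (-eta n δ i j + ε) := by
  have hk0 : (0 : ℝ) < k := by exact_mod_cast hk
  have h6 : ∀ᶠ n : ℕ in atTop, 6 ≤ (n : ℝ) ^ (ε / 2) :=
    tendsto_natCast_atTop_atTop.eventually
      ((tendsto_rpow_atTop (half_pos hε)).eventually_ge_atTop 6)
  filter_upwards [eventually_ge_atTop 1, h6,
    eventually_log_le_rpow (a := 2 * (B * C + C) + 5) (b := 1 / (2 * k ^ 2)) (by positivity)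
      (by positivity) hε] with n hn h6 hlog i j A
  have hn1 : (1 : ℝ) ≤ n := by exact_mod_cast hn
  have hn0 : (0 : ℝ) < n := by linarith
  obtain ⟨γ, _, σ, τ, hσ, hτ, hinj, hcard⟩ := exists_shifts hn hδ₀ hδ₁ i j
  have : Nonempty (Fin k) := ⟨⟨0, hk⟩⟩
  obtain ⟨I, hdisj, hI⟩ := exists_disjoint_subfamily (fun g l => (σ g (i l), τ g (j l))) hinj
  set η := eta n δ i j with hη
  have hη1 : η ≤ 1 / 2 := eta_le_half hδ₁ i j
  have hIk : (n : ℝ) ^ (1 + 2 * η) ≤ 4 * (I.card * k ^ 2) := by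
    refine hcard.trans ?_
    rw [Fintype.card_fin] at hI
    have : (Fintype.card γ : ℝ) ≤ I.card * k ^ 2 := by exact_mod_cast hI
    linarith
  have hIne : I.Nonempty := by
    rw [Finset.nonempty_iff_ne_empty]
    rintro rfl
    have : (0 : ℝ) < (n : ℝ) ^ (1 + 2 * η) := by positivity
    simp at hIk
    linarith
  -- With about n^(1+2η) disjoint copies this choice makes the Hoeffding exponent of order n^(1+ε),
  -- above the entropy gap O(n log n).
  set t : ℝ := (n : ℝ) ^ (-η + ε / 2) with ht
  have ht0 : 0 < t := by positivity
  have hspec := typicalTable_spec _ _ (polytope_margin_nonempty n δ B C)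
  have hmain := abs_uniformTableLaw_sub_geomTableLaw_le hspec.1 hspec.2
    (tables_margin_nonempty n δ B C) σ τ (fun g x => margin_congr (hσ g x))
    (fun g x => margin_congr (hτ g x)) i j I hIne hdisj A ht0.le
  have hent := tableEntropy_typicalTable_le hn hδ₀ hδ₁ hB hC
  have hsq : (n : ℝ) ^ (1 + 2 * η) * t ^ 2 = n * (n : ℝ) ^ ε := by
    rw [ht, ← Real.rpow_natCast, ← Real.rpow_mul hn0.le, ← Real.rpow_add hn0,
      show 1 + 2 * η + (-η + ε / 2) * ((2 : ℕ) : ℝ) = 1 + ε by push_cast; ring,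
      Real.rpow_add hn0, Real.rpow_one]
  have hdev : n * (1 / (2 * k ^ 2) * (n : ℝ) ^ ε) ≤ 2 * I.card * t ^ 2 := by
    have h1 := mul_le_mul_of_nonneg_right hIk (sq_nonneg t)
    rw [hsq] at h1
    have e : n * (1 / (2 * k ^ 2) * (n : ℝ) ^ ε) = n * (n : ℝ) ^ ε / (2 * k ^ 2) := by ring
    rw [e, div_le_iff₀ (by positivity)]
    linarith
  have hexp : Real.exp (tableEntropy (typicalTable (margin n δ B C) (margin n δ B C)
      (polytope_margin_nonempty n δ B C)) -
      Real.log (tables (margin n δ B C) (margin n δ B C)).ncard - 2 * I.card * t ^ 2) ≤ t := by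
    -- The constant 13, against 12 in the entropy bound, leaves a spare factor exp(-n), which is at
    -- most t since η ≤ 1/2.
    have h1 := mul_le_mul_of_nonneg_left hlog hn0.le
    have h2 : Real.exp (-(n : ℝ)) ≤ t := by
      have h3 : Real.log n ≤ n := (Real.log_le_sub_one_of_pos hn0).trans (by linarith)
      have h4 := Real.log_nonneg hn1
      rw [ht, Real.rpow_def_of_pos hn0, Real.exp_le_exp]
      nlinarith
    refine (Real.exp_le_exp.2 ?_).trans h2
    linarith
  have hfin : 6 * t ≤ (n : ℝ) ^ (-η + ε) := by
    rw [show -η + ε = ε / 2 + (-η + ε / 2) by ring, Real.rpow_add hn0]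
    exact mul_le_mul_of_nonneg_right h6 ht0.le
  have hmain' : |(lawX n δ B C).real {M | (fun l => M (i l) (j l)) ∈ A} -
      (lawY n δ B C).real {M | (fun l => M (i l) (j l)) ∈ A}| ≤ t + 2 * t :=
    hmain.trans (by linarith)
  linarith

end Asymptotics

end ContingencyTable

theorem mainTheorem6 (δ B C : ℝ) (hδ₀ : 0 ≤ δ) (hδ₁ : δ ≤ 1) (hB : 0 ≤ B) (hC : 0 ≤ C)
    (k : ℕ) (hk : 1 ≤ k) (ε : ℝ) (hε : 0 < ε) :
    ∀ᶠ n : ℕ in atTop, ∀ i j : Fin k → Fin (ContingencyTable.bezel n δ + n),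
      ContingencyTable.tvDist
          ((ContingencyTable.lawX n δ B C).map fun M => ∏ s, M (i s) (j s))
          ((ContingencyTable.lawY n δ B C).map fun M => ∏ s, M (i s) (j s))
        ≤ (n : ℝ) ^ (-ContingencyTable.eta n δ i j + ε) ∧
      ContingencyTable.tvDist
          ((ContingencyTable.lawX n δ B C).map fun M s => M (i s) (j s))
          ((ContingencyTable.lawY n δ B C).map fun M s => M (i s) (j s))
        ≤ (n : ℝ) ^ (-ContingencyTable.eta n δ i j + ε) := by
  filter_upwards [ContingencyTable.eventually_abs_lawX_sub_lawY_le δ B C hδ₀ hδ₁ hB hC k hk ε hε]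
    with n hn i j
  have hX : IsProbabilityMeasure (ContingencyTable.lawX n δ B C) :=
    isProbabilityMeasure_uniformOn (ContingencyTable.tables_finite _ _)
      (ContingencyTable.tables_margin_nonempty n δ B C)
  have hY : IsProbabilityMeasure (ContingencyTable.lawY n δ B C) :=
    ContingencyTable.isProbabilityMeasure_geomTableLaw _
  have key : ∀ b : ℝ, 2 * (b / 2) = b := fun b => by ring
  constructor
  · rw [← key ((n : ℝ) ^ (-ContingencyTable.eta n δ i j + ε))]
    refine ContingencyTable.tvDist_map_le _ _ _ fun A => ?_
    -- The product is a function of the vector of entries, so its events are among those already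
    -- controlled.
    have := hn i j {v | ∏ s, v s ∈ A}
    rw [le_div_iff₀ two_pos, mul_comm]
    exact this
  · rw [← key ((n : ℝ) ^ (-ContingencyTable.eta n δ i j + ε))]
    refine ContingencyTable.tvDist_map_le _ _ _ fun A => ?_
    rw [le_div_iff₀ two_pos, mul_comm]
    exact hn i j A
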